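/- Let $\ell\ge 1$, let $\mathcal X_1,\dots,\mathcal X_\ell$ be finite query alphabets and $\mathcal A_1,\dots,\mathcal A_\ell$ finite non-empty answer alphabets, and write $\underline{\mathcal X}=\prod_i\mathcal X_i$, $\underline{\mathcal A}=\prod_i\mathcal A_i$, $\mathcal X_I=\prod_{i\in I}\mathcal X_i$, $\mathcal A_I=\prod_{i\in I}\mathcal A_i$ for $I\subset[\ell]$. For a density $P(\underline a|\underline x)\ge 0$ let $P(a_I|\underline x)$ be its marginal on $\mathcal A_I$. $P$ is *no-signalling* (NS), resp. *sub-no-signalling* (SNOS), if for every $I\subsetneq[\ell]$ there are probability distributions $Q(\cdot|x_I)$ on $\mathcal A_I$ with $P(a_I|\underline x)=Q(a_I|x_I)$, resp. $P(a_I|\underline x)\le Q(a_I|x_I)$, for all $\underline x,a_I$. An $\ell$-player game $G$ consists of a probability distribution $T$ on $\underline{\mathcal X}$ and a predicate $V:\underline{\mathcal A}\times\underline{\mathcal X}\to\{0,1\}$; its values $\omega_{NS}(G)$ and $\omega_{SNOS}(G)$ are the maxima of $\sum_{\underline a,\underline x}T(\underline x)V(\underline a,\underline x)P(\underline a|\underline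 x)$ over NS, resp. SNOS, $P$. The games $G^n$ and $G^{t/n}$ ($n,t\in\mathbb N$) have alphabets $\mathcal X_i^n$, $\mathcal A_i^n$ and query distribution $T^{\otimes n}$; they are won iff all $n$, resp. at least $t$, of the $n$ rounds are won. Put $C_\ell=2^{\ell+1}-3$. Call $\Gamma\ge 0$ a *stability constant* for $T$ and $\mathcal A_1,\dots,\mathcal A_\ell$ if, for every conditional probability distribution $P(\underline a|\underline x)$ and every $\epsilon$ such that for each $I\subsetneq[\ell]$ there are probability distributions $Q(\cdot|x_I)$ on $\mathcal A_I$ with $$\tfrac12\sum_{\underline x,a_I}T(\underline x)\,\bigl|P(a_I|\underline x)-Q(a_I|x_I)\bigr|\le\epsilon ,$$ there is a no-signalling $P'$ with $\tfrac12\sum_{\underline x,\underline a}T(\underline x)\,|P'(\underline a|\underline x)-P(\underline a|\underline x)|\le\Gamma\epsilon$. Let $T$ be a probability distribution on $\underline{\mathcal X}$ with full support. Then there is a $\Gamma=\Gamma(T)\geq 0$, depending only on $T$, that is a stability constant for $T$ and all finite non-empty answer alphabets. Moreover, for all answer alphabets, every stability constant $\Gamma$ for $T$ and these alphabets, and every game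 $G$ with query distribution $T$ and these answer alphabets: 1. for every $\epsilon$, $\ \omega_{SNOS}(G)\ge 1-\epsilon\ \Rightarrow\ \omega_{NS}(G)\ge 1-(\Gamma+1)\epsilon$; 2. if $\omega_{NS}(G)\le 1-\delta$ for some $0<\delta<1$, then for every $n\in\mathbb N$, every $0<\alpha\le\delta$ and every integer $t\ge(1-\delta+\alpha)n$, $$\omega_{NS}(G^n)\le\left(1-\frac{\delta^2}{5C_\ell^2(\Gamma+1)^2}\right)^n,\qquad \omega_{NS}(G^{t/n})\le\exp\left(-n\,\frac{\alpha^2}{5C_\ell^2(\Gamma+1)^2}\right).$$ -/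

import Mathlib

universe u v

/-- The restriction `x_I = (x_i : i ∈ I)` of a tuple, an element of `∏_{i ∈ I} Z_i`. -/
def subTuple {ℓ : ℕ} {Z : Fin ℓ → Type*} (I : Finset (Fin ℓ)) (z : ∀ i, Z i) : ∀ i : I, Z i :=
  fun i => z i

open Classical in
/-- The marginal density `P(a_I | x)`, the sum of `P(a | x)` over all `a` extending `a_I`.
Correlations are written `P x a` for `P(a | x)`. -/
noncomputable def marginal {ℓ : ℕ} {X A : Fin ℓ → Type*} [∀ i, Fintype (A i)]
    (P : (∀ i, X i) → (∀ i, A i) → ℝ) (I : Finset (Fin ℓ)) (x : ∀ i, X i) (aI : ∀ i : I, A i) : ℝ :=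
  ∑ a : ∀ i, A i, if subTuple I a = aI then P x a else 0

/-- No-signalling correlations: for every `I ⊊ [ℓ]` the marginal on `I` is given by a
probability distribution depending only on `x_I`. -/
def NS {ℓ : ℕ} (X A : Fin ℓ → Type*) [∀ i, Fintype (A i)] :
    Set ((∀ i, X i) → (∀ i, A i) → ℝ) :=
  {P | (∀ x a, 0 ≤ P x a) ∧
    ∀ I : Finset (Fin ℓ), I ⊂ Finset.univ →
      ∃ Q : (∀ i : I, X i) → (∀ i : I, A i) → ℝ,
        (∀ xI, Q xI ∈ stdSimplex ℝ (∀ i : I, A i)) ∧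
        ∀ x aI, marginal P I x aI = Q (subTuple I x) aI}

/-- Sub-no-signalling correlations: for every `I ⊊ [ℓ]` the marginal on `I` is dominated by a
probability distribution depending only on `x_I`. -/
def SNOS {ℓ : ℕ} (X A : Fin ℓ → Type*) [∀ i, Fintype (A i)] :
    Set ((∀ i, X i) → (∀ i, A i) → ℝ) :=
  {P | (∀ x a, 0 ≤ P x a) ∧
    ∀ I : Finset (Fin ℓ), I ⊂ Finset.univ →
      ∃ Q : (∀ i : I, X i) → (∀ i : I, A i) → ℝ,
        (∀ xI, Q xI ∈ stdSimplex ℝ (∀ i : I, A i)) ∧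
        ∀ x aI, marginal P I x aI ≤ Q (subTuple I x) aI}

/-- An `ℓ`-player game with query alphabets `X i` and answer alphabets `A i`: a probability
distribution `T` on the queries and a binary predicate `V` on answers and queries. -/
structure MultiGame {ℓ : ℕ} (X A : Fin ℓ → Type*) [∀ i, Fintype (X i)] where
  /-- the query distribution -/
  T : (∀ i, X i) → ℝ
  T_mem : T ∈ stdSimplex ℝ (∀ i, X i)
  /-- the winning predicate `V(a, x)` -/
  V : (∀ i, A i) → (∀ i, X i) → Bool

namespace MultiGame

/-- The winning probability `∑ T(x) V(a,x) P(a|x)` of the strategy `P`. -/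
noncomputable def winProb {ℓ : ℕ} {X A : Fin ℓ → Type*} [∀ i, Fintype (X i)]
    [∀ i, Fintype (A i)] (G : MultiGame X A) (P : (∀ i, X i) → (∀ i, A i) → ℝ) : ℝ :=
  ∑ x : ∀ i, X i, ∑ a : ∀ i, A i, G.T x * (if G.V a x = true then 1 else 0) * P x a

/-- The no-signalling value of a game. -/
noncomputable def nsValue {ℓ : ℕ} {X A : Fin ℓ → Type*} [∀ i, Fintype (X i)]
    [∀ i, Fintype (A i)] (G : MultiGame X A) : ℝ :=
  sSup (G.winProb '' NS X A)

/-- The sub-no-signalling value of a game. -/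
noncomputable def snosValue {ℓ : ℕ} {X A : Fin ℓ → Type*} [∀ i, Fintype (X i)]
    [∀ i, Fintype (A i)] (G : MultiGame X A) : ℝ :=
  sSup (G.winProb '' SNOS X A)

end MultiGame

/-- The `k`-th round of a tuple of `n`-letter words. -/
def roundOf {ℓ n : ℕ} {Z : Fin ℓ → Type*} (z : ∀ i, Fin n → Z i) (k : Fin n) : ∀ i, Z i :=
  fun i => z i k

/-- The product distribution `T^{⊗ n}`. -/
def prodDist {ℓ : ℕ} {X : Fin ℓ → Type*} (T : (∀ i, X i) → ℝ) (n : ℕ) :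
    (∀ i, Fin n → X i) → ℝ :=
  fun x => ∏ k : Fin n, T (roundOf x k)

theorem prodDist_mem {ℓ : ℕ} {X : Fin ℓ → Type*} [∀ i, Fintype (X i)] {T : (∀ i, X i) → ℝ}
    (hT : T ∈ stdSimplex ℝ (∀ i, X i)) (n : ℕ) :
    prodDist T n ∈ stdSimplex ℝ (∀ i, Fin n → X i) := by
  refine ⟨fun x => Finset.prod_nonneg fun k _ => hT.1 _, ?_⟩
  have h : ∑ x : ∀ i, Fin n → X i, prodDist T n x
      = ∑ y : Fin n → ∀ i, X i, ∏ k, T (y k) :=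
    Fintype.sum_equiv (Equiv.piComm fun (i : Fin ℓ) (_ : Fin n) => X i) _ _ fun _ => rfl
  rw [h, ← Fintype.prod_sum (fun (_ : Fin n) (y : ∀ i, X i) => T y)]
  simp [hT.2]

namespace MultiGame

/-- The `n`-fold parallel repetition `G^n`: all `n` rounds have to be won. -/
def parallel {ℓ : ℕ} {X A : Fin ℓ → Type*} [∀ i, Fintype (X i)] (G : MultiGame X A) (n : ℕ) :
    MultiGame (fun i => Fin n → X i) (fun i => Fin n → A i) where
  T := prodDist G.T n
  T_mem := prodDist_mem G.T_mem n
  V := fun a x => decide (∀ k : Fin n, G.V (roundOf a k) (roundOf x k) = true)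

/-- The game `G^{t/n}`: at least `t` of the `n` parallel rounds have to be won. -/
def threshold {ℓ : ℕ} {X A : Fin ℓ → Type*} [∀ i, Fintype (X i)] (G : MultiGame X A) (t n : ℕ) :
    MultiGame (fun i => Fin n → X i) (fun i => Fin n → A i) where
  T := prodDist G.T n
  T_mem := prodDist_mem G.T_mem n
  V := fun a x =>
    decide (t ≤ (Finset.univ.filter fun k : Fin n => G.V (roundOf a k) (roundOf x k) = true).card)

end MultiGame

/-- The conditional distribution `P` satisfies the no-signalling constraints up to error `ε`, on
average over `T`: for every `I ⊊ [ℓ]` there is `Q(· | x_I)` with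
`½ ‖T P_{A_I | X} - T Q_{A_I | X_I}‖₁ ≤ ε`. -/
def IsApproxNS {ℓ : ℕ} {X A : Fin ℓ → Type*} [∀ i, Fintype (X i)] [∀ i, Fintype (A i)]
    (T : (∀ i, X i) → ℝ) (P : (∀ i, X i) → (∀ i, A i) → ℝ) (ε : ℝ) : Prop :=
  ∀ I : Finset (Fin ℓ), I ⊂ Finset.univ →
    ∃ Q : (∀ i : I, X i) → (∀ i : I, A i) → ℝ,
      (∀ xI, Q xI ∈ stdSimplex ℝ (∀ i : I, A i)) ∧
      1 / 2 * ∑ x : ∀ i, X i, ∑ aI : ∀ i : I, A i,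
        |T x * marginal P I x aI - T x * Q (subTuple I x) aI| ≤ ε

/-- `Γ ≥ 0` is a stability constant, for the query distribution `T` and answer alphabets `A`, of
the linear system that defines no-signalling: every conditional distribution that satisfies the
constraints up to `ε` is within `Γ ε`, in total variation weighted by `T`, of an exactly
no-signalling one. -/
def IsStabilityConstant {ℓ : ℕ} {X : Fin ℓ → Type*} [∀ i, Fintype (X i)]
    (T : (∀ i, X i) → ℝ) (A : Fin ℓ → Type*) [∀ i, Fintype (A i)] (Γ : ℝ) : Prop :=
  0 ≤ Γ ∧
  ∀ (P : (∀ i, X i) → (∀ i, A i) → ℝ) (ε : ℝ),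
    (∀ x, P x ∈ stdSimplex ℝ (∀ i, A i)) → IsApproxNS T P ε →
      ∃ P' ∈ NS X A,
        1 / 2 * ∑ x : ∀ i, X i, ∑ a : ∀ i, A i, |T x * P' x a - T x * P x a| ≤ Γ * ε

/-- `C_ℓ = 2^{ℓ+1} - 3`. -/
def playerConst (ℓ : ℕ) : ℝ := 2 ^ (ℓ + 1) - 3

/-! Stability. If `T ≥ t > 0` pointwise, approximate no-signalling on average bounds, at every
query, how much each single player signals. `fixPlayer` removes the signalling of one player by a
signed correction; it leaves the players already treated non-signalling and at most triples the
signalling of the others. After all `ℓ` players this yields a signed solution near `P`. Adding one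
and the same function of the answers for every query restores positivity without creating
signalling, and normalising finishes. No constant involves the answer alphabets.

First claim. A sub-no-signalling strategy is completed to a conditional distribution by placing its
missing mass, which is at most its losing probability, on one answer. Stability then makes it
no-signalling.

Second claim, by the method of types. Fix a no-signalling strategy on words and an empirical
distribution `τ` of (query, answer) letters. For `I ⊊ [ℓ]` the law of `a_I` depends on `x_I` alone,
so a change of measure (`sum_type_le`) bounds the probability of seeing `τ` by `(1 - d_I²)^n`, where
`d_I` is the distance of `τ(x, a_I)` from `T(x) τ(a_I | x_I)`. If `τ` wins a fraction at least `1 -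
δ + α`, stability forces `d_I > α / (2(Γ+1))` for some `I`. There are only polynomially many types,
and the polynomial disappears when the bound is applied to independent copies of the strategy. The
resulting rate `α² / (4(Γ+1)²)` does not involve the number of players; `C_ℓ` enters only through
`C_ℓ ≥ 1`. -/

section Correlations

/-! ### Marginals, and removing the signalling of one player -/

variable {ℓ : ℕ} {X A : Fin ℓ → Type*} [∀ i, Fintype (A i)]

open scoped Classical in
theorem marginal_nonneg {P : (∀ i, X i) → (∀ i, A i) → ℝ} (I : Finset (Fin ℓ)) {x : ∀ i, X i}
    (hP : ∀ a, 0 ≤ P x a) (aI : ∀ i : I, A i) : 0 ≤ marginal P I x aI :=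
  Finset.sum_nonneg fun a _ => by split_ifs <;> simp [hP]

open scoped Classical in
theorem marginal_mono {P P' : (∀ i, X i) → (∀ i, A i) → ℝ} (I : Finset (Fin ℓ)) {x : ∀ i, X i}
    (hP : ∀ a, P x a ≤ P' x a) (aI : ∀ i : I, A i) : marginal P I x aI ≤ marginal P' I x aI :=
  Finset.sum_le_sum fun a _ => by split_ifs <;> simp [hP]

open scoped Classical in
theorem sum_mul_marginal (P : (∀ i, X i) → (∀ i, A i) → ℝ) (I : Finset (Fin ℓ)) (x : ∀ i, X i)
    (f : (∀ i : I, A i) → ℝ) :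
    ∑ aI, f aI * marginal P I x aI = ∑ a, f (subTuple I a) * P x a := by
  simp only [marginal, Finset.mul_sum]
  rw [Finset.sum_comm]
  refine Finset.sum_congr rfl fun a _ => ?_
  simp

theorem sum_marginal (P : (∀ i, X i) → (∀ i, A i) → ℝ) (I : Finset (Fin ℓ)) (x : ∀ i, X i) :
    ∑ aI, marginal P I x aI = ∑ a, P x a := by
  simpa using sum_mul_marginal P I x fun _ => 1

/-- The sum of `P(a | x)` over the answer of player `i`. -/
def answerSum (P : (∀ i, X i) → (∀ i, A i) → ℝ) (i : Fin ℓ) (x : ∀ i, X i) (a : ∀ i, A i) : ℝ :=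
  ∑ b, P x (Function.update a i b)

-- Answers with `a i = o i` represent the fibres of forgetting coordinate `i`. Sums over the other
-- players' answers can thus be written over full tuples, without a dependent type of partial ones.
open scoped Classical in
theorem sum_eq_sum_slice (o : ∀ i, A i) (i : Fin ℓ) (h : (∀ i, A i) → ℝ) :
    ∑ a, h a = ∑ a, if a i = o i then ∑ b, h (Function.update a i b) else 0 := by
  rw [← Finset.sum_filter, ← Finset.sum_fiberwise_of_maps_to (s := Finset.univ)
    (t := Finset.univ.filter fun a : ∀ i, A i => a i = o i)
    (g := fun a => Function.update a i (o i)) (by simp)]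
  refine Finset.sum_congr rfl fun a ha => ?_
  have ha' : a i = o i := by simpa using ha
  symm
  refine Finset.sum_bij (fun b _ => Function.update a i b) ?_ ?_ ?_ ?_
  · intro b _
    simp [← ha']
  · intro b _ c _ hbc
    simpa using congrFun hbc i
  · intro c hc
    refine ⟨c i, Finset.mem_univ _, ?_⟩
    have hc' : Function.update c i (o i) = a := by simpa using hc
    simp [← hc']
  · intro b _
    rfl

theorem answerSum_comm (P : (∀ i, X i) → (∀ i, A i) → ℝ) {i k : Fin ℓ} (h : i ≠ k)
    (x : ∀ i, X i) (a : ∀ i, A i) :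
    ∑ b, answerSum P k x (Function.update a i b) = ∑ b, answerSum P i x (Function.update a k b) := by
  unfold answerSum
  rw [Finset.sum_comm]
  refine Finset.sum_congr rfl fun b _ => Finset.sum_congr rfl fun c _ => ?_
  rw [Function.update_comm h]

open scoped Classical in
/-- The correction that makes the sum over the answers of player `k` independent of the query of
player `k`: this query is replaced by `x₀ k`. -/
noncomputable def fixPlayer (o : ∀ i, A i) (x₀ : ∀ i, X i) (k : Fin ℓ)
    (P : (∀ i, X i) → (∀ i, A i) → ℝ) (x : ∀ i, X i) (a : ∀ i, A i) : ℝ :=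
  -- Putting the whole correction on the single answer `o k` makes it count once in the sum over
  -- player `k`'s answers; the result may be negative.
  P x a + if a k = o k then
    answerSum P k (Function.update x k (x₀ k)) a - answerSum P k x a else 0

theorem answerSum_update_self (P : (∀ i, X i) → (∀ i, A i) → ℝ) (k : Fin ℓ)
    (x : ∀ i, X i) (a : ∀ i, A i) (b : A k) :
    answerSum P k x (Function.update a k b) = answerSum P k x a := by
  simp [answerSum]

open scoped Classical in
theorem answerSum_fixPlayer_self (o : ∀ i, A i) (x₀ : ∀ i, X i) (k : Fin ℓ)
    (P : (∀ i, X i) → (∀ i, A i) → ℝ) (x : ∀ i, X i) (a : ∀ i, A i) :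
    answerSum (fixPlayer o x₀ k P) k x a = answerSum P k (Function.update x k (x₀ k)) a := by
  have h : answerSum (fixPlayer o x₀ k P) k x a = answerSum P k x a
      + (answerSum P k (Function.update x k (x₀ k)) a - answerSum P k x a) := by
    conv_lhs => unfold answerSum fixPlayer
    rw [Finset.sum_add_distrib]
    congr 1
    simp [answerSum_update_self]
  rw [h]; ring

-- Summations over the answers of two players commute, so the correction for `k` changes the sums of
-- `i` only by combinations of sums of `i`. Hence a player who does not signal stays so.
open scoped Classical in
theorem answerSum_fixPlayer_of_ne (o : ∀ i, A i) (x₀ : ∀ i, X i) {i k : Fin ℓ} (hik : i ≠ k)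
    (P : (∀ i, X i) → (∀ i, A i) → ℝ) (x : ∀ i, X i) (a : ∀ i, A i) :
    answerSum (fixPlayer o x₀ k P) i x a = answerSum P i x a + if a k = o k then
      ∑ b, (answerSum P i (Function.update x k (x₀ k)) (Function.update a k b)
        - answerSum P i x (Function.update a k b)) else 0 := by
  conv_lhs => unfold answerSum fixPlayer
  rw [Finset.sum_add_distrib]
  congr 1
  simp only [ne_eq, hik.symm, not_false_eq_true, Function.update_of_ne]
  split_ifs
  · rw [Finset.sum_sub_distrib, Finset.sum_sub_distrib, answerSum_comm P hik, answerSum_comm P hik]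
  · simp

open scoped Classical in
theorem sum_abs_slice_le (o : ∀ i, A i) (k : Fin ℓ) (h : (∀ i, A i) → ℝ) :
    ∑ a, (if a k = o k then |∑ b, h (Function.update a k b)| else 0) ≤ ∑ a, |h a| := by
  rw [sum_eq_sum_slice o k fun a => |h a|]
  refine Finset.sum_le_sum fun a _ => ?_
  split_ifs
  · exact Finset.abs_sum_le_sum_abs _ _
  · exact le_rfl

open scoped Classical in
/-- The distance in total mass, up to which `P` fails to be independent of the query of
player `i` after summation over the answer of `i`, is at most `η`. -/
def SignalBound (o : ∀ i, A i) (P : (∀ i, X i) → (∀ i, A i) → ℝ) (i : Fin ℓ) (η : ℝ) : Prop :=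
  ∀ x v, ∑ a, (if a i = o i then
    |answerSum P i (Function.update x i v) a - answerSum P i x a| else 0) ≤ η

-- The factor 3 counts three differences in the query of `i`: the original one, and the two from the
-- correction term, at `x` and at `x` with the query of `k` reset. Summing out the answer of `k`
-- contracts the `ℓ¹` norm, so each is at most `η`.
open scoped Classical in
theorem SignalBound.fixPlayer_of_ne {o : ∀ i, A i} {x₀ : ∀ i, X i} {i k : Fin ℓ} (hik : i ≠ k)
    {P : (∀ i, X i) → (∀ i, A i) → ℝ} {η : ℝ} (h : SignalBound o P i η) :
    SignalBound o (fixPlayer o x₀ k P) i (3 * η) := by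
  intro x v
  have key : ∀ y : ∀ i, X i, ∑ a, (if a k = o k then |∑ b, if a i = o i then
      (answerSum P i (Function.update y i v) (Function.update a k b)
        - answerSum P i y (Function.update a k b)) else 0| else 0) ≤ η := fun y => by
    have e := sum_abs_slice_le o k fun a => if a i = o i then
      (answerSum P i (Function.update y i v) a - answerSum P i y a) else 0
    simp only [ne_eq, hik, not_false_eq_true, Function.update_of_ne] at e
    refine e.trans (le_trans (le_of_eq ?_) (h y v))
    refine Finset.sum_congr rfl fun a _ => ?_
    rw [apply_ite abs, abs_zero]
  have h1 := h x v
  have h2 := key x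
  have h3 := key (Function.update x k (x₀ k))
  have : 3 * η = η + η + η := by ring
  rw [this]
  refine le_trans ?_ (add_le_add (add_le_add h1 h2) h3)
  rw [← Finset.sum_add_distrib, ← Finset.sum_add_distrib]
  refine Finset.sum_le_sum fun a _ => ?_
  rw [answerSum_fixPlayer_of_ne o x₀ hik, answerSum_fixPlayer_of_ne o x₀ hik]
  by_cases hi : a i = o i <;> by_cases hk : a k = o k <;>
    simp only [hi, hk, if_true, if_false, Finset.sum_sub_distrib, add_zero, le_refl, Finset.sum_const_zero,
      abs_zero]
  rw [Function.update_comm hik.symm]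
  generalize answerSum P i (Function.update x i v) a = p1
  generalize answerSum P i x a = p2
  generalize ∑ b, answerSum P i (Function.update (Function.update x i v) k (x₀ k)) (Function.update a k b) = p3
  generalize ∑ b, answerSum P i (Function.update x i v) (Function.update a k b) = p4
  generalize ∑ b, answerSum P i (Function.update x k (x₀ k)) (Function.update a k b) = p5
  generalize ∑ b, answerSum P i x (Function.update a k b) = p6
  have e : p1 + (p3 - p4) - (p2 + (p5 - p6)) = (p1 - p2) - (p4 - p6) + (p3 - p5) := by ring
  rw [e]
  exact (abs_add_le _ _).trans (add_le_add_left (abs_sub _ _) _)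

end Correlations

/-! ### From approximate to exact no-signalling -/

section Stability

variable {ℓ : ℕ} {X A : Fin ℓ → Type*} [∀ i, Fintype (A i)]

open scoped Classical in
theorem SignalBound.fixPlayer_self {o : ∀ i, A i} {x₀ : ∀ i, X i} {k : Fin ℓ}
    {P : (∀ i, X i) → (∀ i, A i) → ℝ} {η : ℝ} (hη : 0 ≤ η) :
    SignalBound o (fixPlayer o x₀ k P) k η := by
  intro x v
  simpa [answerSum_fixPlayer_self] using hη

open scoped Classical in
theorem sum_abs_fixPlayer_sub_le {o : ∀ i, A i} {x₀ : ∀ i, X i} {k : Fin ℓ}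
    {P : (∀ i, X i) → (∀ i, A i) → ℝ} {η : ℝ} (h : SignalBound o P k η) (x : ∀ i, X i) :
    ∑ a, |fixPlayer o x₀ k P x a - P x a| ≤ η := by
  refine le_trans (le_of_eq ?_) (h x (x₀ k))
  refine Finset.sum_congr rfl fun a _ => ?_
  rw [fixPlayer, add_sub_cancel_left, apply_ite abs, abs_zero]

open scoped Classical in
theorem sum_fixPlayer {o : ∀ i, A i} {x₀ : ∀ i, X i} {k : Fin ℓ}
    {P : (∀ i, X i) → (∀ i, A i) → ℝ} (hP : ∀ x, ∑ a, P x a = 1) (x : ∀ i, X i) :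
    ∑ a, fixPlayer o x₀ k P x a = 1 := by
  have h : ∀ y, ∑ a, (if a k = o k then answerSum P k y a else 0) = 1 := fun y => by
    rw [← hP y, sum_eq_sum_slice o k (P y)]
    rfl
  have e : ∀ a, fixPlayer o x₀ k P x a = P x a
      + ((if a k = o k then answerSum P k (Function.update x k (x₀ k)) a else 0)
        - (if a k = o k then answerSum P k x a else 0)) := fun a => by
    unfold fixPlayer; split_ifs <;> simp
  simp only [e, Finset.sum_add_distrib, Finset.sum_sub_distrib, h, hP]
  norm_num

theorem answerSum_fixPlayer_update_of_ne {o : ∀ i, A i} {x₀ : ∀ i, X i} {i k : Fin ℓ} (hik : i ≠ k)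
    {P : (∀ i, X i) → (∀ i, A i) → ℝ}
    (h : ∀ x v a, answerSum P i (Function.update x i v) a = answerSum P i x a)
    (x : ∀ i, X i) (v : X i) (a : ∀ i, A i) :
    answerSum (fixPlayer o x₀ k P) i (Function.update x i v) a
      = answerSum (fixPlayer o x₀ k P) i x a := by
  rw [answerSum_fixPlayer_of_ne o x₀ hik, answerSum_fixPlayer_of_ne o x₀ hik,
    Function.update_comm hik]
  simp only [h]

/-- An approximately no-signalling correlation is close to a signed correlation in which no
player of `s` signals. -/
theorem exists_signed_correction {o : ∀ i, A i} (x₀ : ∀ i, X i)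
    {P : (∀ i, X i) → (∀ i, A i) → ℝ} {η : ℝ} (hη : 0 ≤ η) (hP : ∀ x, ∑ a, P x a = 1)
    (h : ∀ i, SignalBound o P i η) (s : Finset (Fin ℓ)) :
    ∃ P' : (∀ i, X i) → (∀ i, A i) → ℝ, (∀ x, ∑ a, P' x a = 1) ∧
      (∀ i ∈ s, ∀ x v a, answerSum P' i (Function.update x i v) a = answerSum P' i x a) ∧
      (∀ i, SignalBound o P' i (3 ^ s.card * η)) ∧
      ∀ x, ∑ a, |P' x a - P x a| ≤ 3 ^ s.card * η := by
  induction s using Finset.induction_on with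
  | empty => exact ⟨P, hP, by simp, by simpa using h, fun x => by simpa using hη⟩
  | insert k s hk ih =>
    obtain ⟨P', h1, h2, h3, h4⟩ := ih
    have hc : (3 : ℝ) ^ (insert k s).card * η = 3 * (3 ^ s.card * η) := by
      rw [Finset.card_insert_of_notMem hk]; ring
    have h0 : 0 ≤ 3 ^ s.card * η := by positivity
    rw [hc]
    refine ⟨fixPlayer o x₀ k P', sum_fixPlayer h1, ?_, ?_, ?_⟩
    · intro i hi x v a
      by_cases hik : i = k
      · subst hik
        simp [answerSum_fixPlayer_self]
      · exact answerSum_fixPlayer_update_of_ne hik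
          (h2 i ((Finset.mem_insert.1 hi).resolve_left hik)) x v a
    · intro i
      by_cases hik : i = k
      · subst hik
        exact SignalBound.fixPlayer_self (by positivity)
      · exact (h3 i).fixPlayer_of_ne hik
    · intro x
      have := sum_abs_fixPlayer_sub_le (x₀ := x₀) (h3 k) x
      calc ∑ a, |fixPlayer o x₀ k P' x a - P x a|
          ≤ ∑ a, (|fixPlayer o x₀ k P' x a - P' x a| + |P' x a - P x a|) :=
            Finset.sum_le_sum fun a _ => abs_sub_le _ _ _
        -- The old and the new displacement are each at most `3 ^ s.card * η`; the sum is rounded up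
        -- from 2 to 3 to match the signalling bound.
        _ ≤ 3 * (3 ^ s.card * η) := by
            rw [Finset.sum_add_distrib]
            linarith [h4 x]

open scoped Classical in
theorem marginal_update_of_answerSum {P : (∀ i, X i) → (∀ i, A i) → ℝ} {j : Fin ℓ}
    (h : ∀ x v a, answerSum P j (Function.update x j v) a = answerSum P j x a)
    (o : ∀ i, A i) {I : Finset (Fin ℓ)} (hj : j ∉ I) (x : ∀ i, X i) (v : X j)
    (aI : ∀ i : I, A i) :
    marginal P I (Function.update x j v) aI = marginal P I x aI := by
  have hs : ∀ (a : ∀ i, A i) (b : A j), subTuple I (Function.update a j b) = subTuple I a := by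
    intro a b
    funext i
    exact Function.update_of_ne (fun e : (i : Fin ℓ) = j => hj (e ▸ i.2)) _ _
  have e : ∀ y, marginal P I y aI
      = ∑ a, if a j = o j then if subTuple I a = aI then answerSum P j y a else 0 else 0 := by
    intro y
    rw [marginal, sum_eq_sum_slice o j]
    refine Finset.sum_congr rfl fun a _ => ?_
    congr 1
    simp only [hs, answerSum]
    split_ifs <;> simp
  simp only [e, h]

/-- Single-player conditions suffice: the queries outside `I` can be moved to `x₀` one at a time,
each move leaving the marginal on `I` unchanged. -/
theorem mem_NS_of_answerSum {P : (∀ i, X i) → (∀ i, A i) → ℝ} (x₀ : ∀ i, X i) (o : ∀ i, A i)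
    (hP : ∀ x, P x ∈ stdSimplex ℝ (∀ i, A i))
    (h : ∀ j x v a, answerSum P j (Function.update x j v) a = answerSum P j x a) :
    P ∈ NS X A := by
  classical
  refine ⟨fun x => (hP x).1, fun I _ => ⟨fun xI => marginal P I
    fun i => if hi : i ∈ I then xI ⟨i, hi⟩ else x₀ i, fun xI => ⟨?_, ?_⟩, ?_⟩⟩
  · exact marginal_nonneg I (hP _).1
  · rw [sum_marginal]
    exact (hP _).2
  · intro x aI
    set x' : ∀ i, X i := fun i => if hi : i ∈ I then subTuple I x ⟨i, hi⟩ else x₀ i with hx'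
    have key : ∀ s : Finset (Fin ℓ), Disjoint s I →
        marginal P I (s.piecewise x' x) aI = marginal P I x aI := by
      intro s
      induction s using Finset.induction_on with
      | empty => simp
      | insert j s hj ih =>
        intro hs
        rw [Finset.disjoint_insert_left] at hs
        rw [Finset.piecewise_insert, marginal_update_of_answerSum (h j) o hs.1, ih hs.2]
    rw [← key Iᶜ disjoint_compl_left]
    congr 1
    funext i
    by_cases hi : i ∈ I <;> simp [Finset.piecewise, hi, hx', subTuple]

open scoped Classical in
theorem marginal_erase (P : (∀ i, X i) → (∀ i, A i) → ℝ) (i : Fin ℓ) (x : ∀ i, X i)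
    (a : ∀ i, A i) :
    marginal P (Finset.univ.erase i) x (subTuple _ a) = answerSum P i x a := by
  rw [marginal, ← Finset.sum_filter, answerSum]
  symm
  refine Finset.sum_bij (fun b _ => Function.update a i b) ?_ ?_ ?_ ?_
  · intro b _
    simp only [Finset.mem_filter, Finset.mem_univ, true_and]
    funext j
    exact Function.update_of_ne (Finset.ne_of_mem_erase j.2) _ _
  · intro b _ c _ hbc
    simpa using congrFun hbc i
  · intro c hc
    refine ⟨c i, Finset.mem_univ _, ?_⟩
    have hc' : subTuple (Finset.univ.erase i) c = subTuple _ a := by simpa using hc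
    funext j
    by_cases hj : j = i
    · subst hj; simp
    · rw [Function.update_of_ne hj]
      exact (congrFun hc' ⟨j, by simp [hj]⟩).symm
  · intro b _
    rfl

open scoped Classical in
theorem sum_slice_le_sum_subTuple (o : ∀ i, A i) (i : Fin ℓ)
    {F : (∀ j : (Finset.univ.erase i : Finset (Fin ℓ)), A j) → ℝ} (hF : ∀ y, 0 ≤ F y) :
    ∑ a : ∀ i, A i, (if a i = o i then F (subTuple _ a) else 0) ≤ ∑ y, F y := by
  rw [← Finset.sum_filter]
  refine le_trans (le_of_eq ?_) (Finset.sum_le_univ_sum_of_nonneg hF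
    (s := (Finset.univ.filter fun a : ∀ i, A i => a i = o i).image (subTuple _)))
  rw [Finset.sum_image]
  intro a ha b hb hab
  have ha' : a i = o i := by simpa using ha
  have hb' : b i = o i := by simpa using hb
  funext j
  by_cases hj : j = i
  · subst hj; rw [ha', hb']
  · exact congrFun hab ⟨j, by simp [hj]⟩

/-- A signed correlation in which no player signals, within `r` of a conditional distribution, is
turned into a no-signalling one by adding the negative parts for all queries. -/
theorem exists_NS_of_signed [∀ i, Fintype (X i)] (x₀ : ∀ i, X i) (o : ∀ i, A i)
    {P S : (∀ i, X i) → (∀ i, A i) → ℝ} {r : ℝ}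
    (hP : ∀ x a, 0 ≤ P x a) (hS : ∀ x, ∑ a, S x a = 1)
    (h : ∀ j x v a, answerSum S j (Function.update x j v) a = answerSum S j x a)
    (hr : ∀ x, ∑ a, |S x a - P x a| ≤ r) :
    ∃ P' ∈ NS X A, ∀ x, ∑ a, |P' x a - P x a| ≤ (2 * Fintype.card (∀ i, X i) + 1) * r := by
  -- `R` does not depend on the query, so adding it creates no signalling, and it dominates every
  -- negative part of `S` because `P ≥ 0`.
  set R : (∀ i, A i) → ℝ := fun a => ∑ y, |S y a - P y a| with hR
  have hR0 : ∀ a, 0 ≤ R a := fun a => Finset.sum_nonneg fun y _ => abs_nonneg _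
  set m := ∑ a, R a with hm
  have hm0 : 0 ≤ m := Finset.sum_nonneg fun a _ => hR0 a
  have hmr : m ≤ Fintype.card (∀ i, X i) * r := by
    rw [hm, hR, Finset.sum_comm]
    refine (Finset.sum_le_sum fun y _ => hr y).trans ?_
    simp
  have hpos : ∀ x a, 0 ≤ S x a + R a := fun x a => by
    have h1 : |S x a - P x a| ≤ R a :=
      Finset.single_le_sum (f := fun y => |S y a - P y a|) (fun y _ => abs_nonneg _)
        (Finset.mem_univ x)
    have h2 := neg_abs_le (S x a - P x a)
    linarith [hP x a]
  have hsum : ∀ x, ∑ a, (S x a + R a) = 1 + m := fun x => by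
    rw [Finset.sum_add_distrib, hS]
  have hm1 : 0 < 1 + m := by linarith
  refine ⟨fun x a => (S x a + R a) / (1 + m), mem_NS_of_answerSum x₀ o
    (fun x => ⟨fun a => div_nonneg (hpos x a) hm1.le, ?_⟩) ?_, ?_⟩
  · rw [← Finset.sum_div, hsum, div_self hm1.ne']
  · intro j x v a
    have := h j x v a
    simp only [answerSum] at this ⊢
    rw [← Finset.sum_div, ← Finset.sum_div, Finset.sum_add_distrib, Finset.sum_add_distrib, this]
  · intro x
    -- Summed over `a`, the terms cost `m` for normalising, `m` for adding `R`, and `r` for `S - P`;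
    -- with `m ≤ |X| r` this is `(2|X| + 1) r`.
    have e : ∀ a, |(S x a + R a) / (1 + m) - P x a|
        ≤ (S x a + R a) * (m / (1 + m)) + R a + |S x a - P x a| := fun a => by
      have h1 : (S x a + R a) / (1 + m) - P x a
          = -((S x a + R a) * (m / (1 + m))) + R a + (S x a - P x a) := by
        field_simp; ring
      rw [h1]
      refine (abs_add_three _ _ _).trans (le_of_eq ?_)
      rw [abs_neg, abs_of_nonneg (hR0 a),
        abs_of_nonneg (mul_nonneg (hpos x a) (div_nonneg hm0 hm1.le))]
    refine (Finset.sum_le_sum fun a _ => e a).trans ?_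
    rw [Finset.sum_add_distrib, Finset.sum_add_distrib, ← Finset.sum_mul, hsum, ← hm,
      mul_div_cancel₀ _ hm1.ne']
    linarith [hr x]

theorem IsApproxNS.nonneg [∀ i, Fintype (X i)] (hℓ : 1 ≤ ℓ) {T : (∀ i, X i) → ℝ}
    {P : (∀ i, X i) → (∀ i, A i) → ℝ} {ε : ℝ} (h : IsApproxNS T P ε) : 0 ≤ ε := by
  have : Nonempty (Fin ℓ) := ⟨⟨0, hℓ⟩⟩
  obtain ⟨Q, -, hQ⟩ := h ∅ (Finset.empty_ssubset.2 Finset.univ_nonempty)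
  exact le_trans (by positivity) hQ

/-- Since `T ≥ t`, the averaged error `2ε` is at most `2ε / t` at each query. Two queries differing
only at `i` share the same `Q`, so the triangle inequality doubles this. -/
theorem IsApproxNS.signalBound [∀ i, Fintype (X i)] {T : (∀ i, X i) → ℝ} {t : ℝ} (ht : 0 < t)
    (hT : ∀ x, t ≤ T x) {P : (∀ i, X i) → (∀ i, A i) → ℝ} {ε : ℝ} (h : IsApproxNS T P ε)
    (o : ∀ i, A i) (i : Fin ℓ) : SignalBound o P i (4 * ε / t) := by
  classical
  obtain ⟨Q, -, hQ⟩ := h (Finset.univ.erase i) (Finset.erase_ssubset (Finset.mem_univ i))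
  have h1 : ∀ x, ∑ aI, |marginal P (Finset.univ.erase i) x aI - Q (subTuple _ x) aI|
      ≤ 2 * ε / t := fun x => by
    have h2 := Finset.single_le_sum (f := fun x => ∑ aI,
      |T x * marginal P (Finset.univ.erase i) x aI - T x * Q (subTuple _ x) aI|)
      (fun x _ => Finset.sum_nonneg fun a _ => abs_nonneg _) (Finset.mem_univ x)
    have hTx : 0 ≤ T x := ht.le.trans (hT x)
    simp only [← mul_sub, abs_mul, abs_of_nonneg hTx, ← Finset.mul_sum] at h2 hQ
    rw [le_div_iff₀ ht]
    have h3 := mul_le_mul_of_nonneg_right (hT x) (Finset.sum_nonneg fun aI _ =>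
      abs_nonneg (marginal P (Finset.univ.erase i) x aI - Q (subTuple _ x) aI)
      : 0 ≤ ∑ aI, |marginal P (Finset.univ.erase i) x aI - Q (subTuple _ x) aI|)
    linarith
  intro x v
  have hx : subTuple (Finset.univ.erase i) (Function.update x i v) = subTuple _ x := by
    funext j
    exact Function.update_of_ne (Finset.ne_of_mem_erase j.2) _ _
  have h3 := h1 (Function.update x i v)
  have h4 := h1 x
  rw [hx] at h3
  have h5 := sum_slice_le_sum_subTuple o i (F := fun aI =>
    |marginal P (Finset.univ.erase i) (Function.update x i v) aI
      - marginal P (Finset.univ.erase i) x aI|) fun _ => abs_nonneg _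
  simp only [marginal_erase] at h5
  refine h5.trans ?_
  calc _ ≤ ∑ aI, (|marginal P (Finset.univ.erase i) (Function.update x i v) aI
        - Q (subTuple _ x) aI|
        + |marginal P (Finset.univ.erase i) x aI - Q (subTuple _ x) aI|) := by
        refine Finset.sum_le_sum fun aI _ => ?_
        rw [abs_sub_comm (marginal P (Finset.univ.erase i) x aI)]
        exact abs_sub_le _ _ _
    _ ≤ 4 * ε / t := by
        rw [Finset.sum_add_distrib]
        have : 4 * ε / t = 2 * ε / t + 2 * ε / t := by ring
        linarith

end Stability

/-- The constant is the product of `1/2`, the factor `2|X| + 1` for positivity, `3 ^ ℓ` for the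
players, and `4 / t` for the signalling bound. -/
theorem isStabilityConstant_of_le {ℓ : ℕ} (hℓ : 1 ≤ ℓ) {X : Fin ℓ → Type u} [∀ i, Fintype (X i)]
    {T : (∀ i, X i) → ℝ} (hT : T ∈ stdSimplex ℝ (∀ i, X i)) {t : ℝ} (ht : 0 < t)
    (htT : ∀ x, t ≤ T x) (A : Fin ℓ → Type v) [∀ i, Fintype (A i)] [∀ i, Nonempty (A i)] :
    IsStabilityConstant T A (2 * (2 * Fintype.card (∀ i, X i) + 1) * 3 ^ ℓ / t) := by
  refine ⟨by positivity, fun P ε hP h => ?_⟩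
  have hε := h.nonneg hℓ
  obtain ⟨x₀⟩ : Nonempty (∀ i, X i) := by
    by_contra hne
    rw [not_nonempty_iff] at hne
    simpa using hT.2
  let o : ∀ i, A i := fun i => Classical.arbitrary _
  obtain ⟨S, h1, h2, -, h4⟩ := exists_signed_correction (o := o) x₀ (by positivity)
    (fun x => (hP x).2) (h.signalBound ht htT o) Finset.univ
  obtain ⟨P', hP', h5⟩ := exists_NS_of_signed x₀ o (fun x => (hP x).1) h1
    (fun j => h2 j (Finset.mem_univ j)) h4
  refine ⟨P', hP', ?_⟩
  have h6 : ∀ x, ∑ a, |T x * P' x a - T x * P x a| ≤ T x *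
      ((2 * Fintype.card (∀ i, X i) + 1) * (3 ^ ℓ * (4 * ε / t))) := fun x => by
    simp only [← mul_sub, abs_mul, abs_of_nonneg (hT.1 x), ← Finset.mul_sum]
    have := h5 x
    rw [Finset.card_univ, Fintype.card_fin] at this
    exact mul_le_mul_of_nonneg_left this (hT.1 x)
  have h7 := Finset.sum_le_sum fun x (_ : x ∈ Finset.univ) => h6 x
  rw [← Finset.sum_mul, hT.2, one_mul] at h7
  calc _ ≤ 1 / 2 * ((2 * Fintype.card (∀ i, X i) + 1) * (3 ^ ℓ * (4 * ε / t))) := by gcongr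
    _ = _ := by ring

theorem exists_isStabilityConstant {ℓ : ℕ} (hℓ : 1 ≤ ℓ) {X : Fin ℓ → Type u} [∀ i, Fintype (X i)]
    {T : (∀ i, X i) → ℝ} (hT : T ∈ stdSimplex ℝ (∀ i, X i)) (hfull : ∀ x, 0 < T x) :
    ∃ Γ : ℝ, ∀ (A : Fin ℓ → Type v) [∀ i, Fintype (A i)] [∀ i, Nonempty (A i)],
      IsStabilityConstant T A Γ := by
  obtain ⟨t, ht, htT⟩ : ∃ t : ℝ, 0 < t ∧ ∀ x, t ≤ T x := by
    cases isEmpty_or_nonempty (∀ i, X i) with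
    | inl h => exact ⟨1, one_pos, fun x => h.elim x⟩
    | inr h =>
      obtain ⟨x, hx⟩ := Finite.exists_min T
      exact ⟨T x, hfull x, hx⟩
  exact ⟨_, fun A _ _ => isStabilityConstant_of_le hℓ hT ht htT A⟩

/-! ### Game values: sub-no-signalling against no-signalling -/

/-- Two densities of equal mass differ on an event by at most half their `ℓ¹` distance. -/
theorem sum_mul_sub_le_half_sum_abs {Z : Type*} [Fintype Z] {f p q : Z → ℝ} (h0 : ∀ z, 0 ≤ f z)
    (h1 : ∀ z, f z ≤ 1) (h : ∑ z, p z = ∑ z, q z) :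
    ∑ z, f z * (p z - q z) ≤ 1 / 2 * ∑ z, |p z - q z| := by
  -- Equal masses allow `f` to be centred at `1/2`, after which it is bounded by `1/2`.
  have e : ∑ z, f z * (p z - q z) = ∑ z, (f z - 1 / 2) * (p z - q z) := by
    simp only [sub_mul (f _), Finset.sum_sub_distrib, ← Finset.mul_sum, h, sub_self, mul_zero,
      sub_zero]
  rw [e, Finset.mul_sum]
  refine Finset.sum_le_sum fun z _ => (le_abs_self _).trans ?_
  rw [abs_mul]
  refine mul_le_mul_of_nonneg_right (abs_le.2 ⟨?_, ?_⟩) (abs_nonneg _)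
  · linarith [h0 z]
  · linarith [h1 z]

section Values

variable {ℓ : ℕ} {X A : Fin ℓ → Type*} [∀ i, Fintype (A i)]

theorem NS_subset_SNOS : NS X A ⊆ SNOS X A := fun _ hP => ⟨hP.1, fun I hI => by
  obtain ⟨Q, hQ, h⟩ := hP.2 I hI
  exact ⟨Q, hQ, fun x aI => (h x aI).le⟩⟩

theorem sum_eq_one_of_mem_NS (hℓ : 1 ≤ ℓ) {P : (∀ i, X i) → (∀ i, A i) → ℝ} (hP : P ∈ NS X A)
    (x : ∀ i, X i) : ∑ a, P x a = 1 := by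
  have : Nonempty (Fin ℓ) := ⟨⟨0, hℓ⟩⟩
  obtain ⟨Q, hQ, h⟩ := hP.2 ∅ (Finset.empty_ssubset.2 Finset.univ_nonempty)
  rw [← sum_marginal P ∅ x]
  simp only [h]
  exact (hQ _).2

theorem sum_le_one_of_mem_SNOS (hℓ : 1 ≤ ℓ) {P : (∀ i, X i) → (∀ i, A i) → ℝ}
    (hP : P ∈ SNOS X A) (x : ∀ i, X i) : ∑ a, P x a ≤ 1 := by
  have : Nonempty (Fin ℓ) := ⟨⟨0, hℓ⟩⟩
  obtain ⟨Q, hQ, h⟩ := hP.2 ∅ (Finset.empty_ssubset.2 Finset.univ_nonempty)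
  rw [← sum_marginal P ∅ x, ← (hQ (subTuple ∅ x)).2]
  exact Finset.sum_le_sum fun aI _ => h x aI

theorem zero_mem_SNOS [∀ i, Nonempty (A i)] : (fun _ _ => 0) ∈ SNOS X A := by
  classical
  refine ⟨fun _ _ => le_rfl, fun I _ =>
    ⟨fun _ => Pi.single (Classical.arbitrary _) 1, fun _ => single_mem_stdSimplex ℝ _, fun x aI => ?_⟩⟩
  have h := (single_mem_stdSimplex ℝ (Classical.arbitrary (∀ i : I, A i))).1 aI
  simpa [marginal] using h

variable [∀ i, Fintype (X i)]

theorem MultiGame.winProb_le_sum (G : MultiGame X A) {P : (∀ i, X i) → (∀ i, A i) → ℝ}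
    (hP : ∀ x a, 0 ≤ P x a) : G.winProb P ≤ ∑ x, G.T x * ∑ a, P x a := by
  refine Finset.sum_le_sum fun x _ => ?_
  rw [Finset.mul_sum]
  refine Finset.sum_le_sum fun a _ => mul_le_mul_of_nonneg_right ?_ (hP x a)
  have := G.T_mem.1 x
  split_ifs <;> simp [this]

theorem MultiGame.winProb_le_one (hℓ : 1 ≤ ℓ) (G : MultiGame X A)
    {P : (∀ i, X i) → (∀ i, A i) → ℝ} (hP : P ∈ SNOS X A) : G.winProb P ≤ 1 := by
  refine (G.winProb_le_sum hP.1).trans ?_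
  rw [← G.T_mem.2]
  refine Finset.sum_le_sum fun x _ => ?_
  exact mul_le_of_le_one_right (G.T_mem.1 x) (sum_le_one_of_mem_SNOS hℓ hP x)

theorem MultiGame.winProb_le_nsValue (hℓ : 1 ≤ ℓ) (G : MultiGame X A)
    {P : (∀ i, X i) → (∀ i, A i) → ℝ} (hP : P ∈ NS X A) : G.winProb P ≤ G.nsValue :=
  le_csSup ⟨1, by rintro _ ⟨P, hP, rfl⟩; exact G.winProb_le_one hℓ (NS_subset_SNOS hP)⟩ ⟨P, hP, rfl⟩

theorem MultiGame.winProb_sub_le (G : MultiGame X A) {P P' : (∀ i, X i) → (∀ i, A i) → ℝ}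
    (h : ∀ x, ∑ a, P x a = ∑ a, P' x a) : G.winProb P - G.winProb P'
      ≤ 1 / 2 * ∑ x, ∑ a, |G.T x * P' x a - G.T x * P x a| := by
  have := sum_mul_sub_le_half_sum_abs (Z := (∀ i, X i) × (∀ i, A i))
    (f := fun z => if G.V z.2 z.1 = true then 1 else 0) (p := fun z => G.T z.1 * P z.1 z.2)
    (q := fun z => G.T z.1 * P' z.1 z.2) (fun z => by split_ifs <;> simp)
    (fun z => by split_ifs <;> simp)
    (by simp only [Fintype.sum_prod_type, ← Finset.mul_sum, h])
  simp only [Fintype.sum_prod_type] at this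
  simp only [abs_sub_comm (G.T _ * P' _ _)]
  refine le_trans (le_of_eq ?_) this
  unfold winProb
  rw [← Finset.sum_sub_distrib]
  refine Finset.sum_congr rfl fun x _ => ?_
  rw [← Finset.sum_sub_distrib]
  refine Finset.sum_congr rfl fun a _ => ?_
  ring

open scoped Classical in
/-- A sub-no-signalling correlation is completed to a conditional distribution that is
no-signalling up to the missing mass. -/
theorem exists_completion [∀ i, Nonempty (A i)] (hℓ : 1 ≤ ℓ) {T : (∀ i, X i) → ℝ}
    (hT : T ∈ stdSimplex ℝ (∀ i, X i)) {P : (∀ i, X i) → (∀ i, A i) → ℝ} (hP : P ∈ SNOS X A) :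
    ∃ P' : (∀ i, X i) → (∀ i, A i) → ℝ, (∀ x, P' x ∈ stdSimplex ℝ (∀ i, A i)) ∧
      (∀ x a, P x a ≤ P' x a) ∧ IsApproxNS T P' (1 - ∑ x, T x * ∑ a, P x a) := by
  let o : ∀ i, A i := fun i => Classical.arbitrary _
  have hm := sum_le_one_of_mem_SNOS hℓ hP
  set P' : (∀ i, X i) → (∀ i, A i) → ℝ :=
    fun x a => P x a + if a = o then 1 - ∑ a, P x a else 0 with hP'
  have hle : ∀ x a, P x a ≤ P' x a := fun x a => by
    have := hm x
    simp only [hP']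
    split_ifs <;> linarith
  have hsum : ∀ x, ∑ a, P' x a = 1 := fun x => by
    simp [hP', Finset.sum_add_distrib]
  refine ⟨P', fun x => ⟨fun a => (hP.1 x a).trans (hle x a), hsum x⟩, hle, fun I hI => ?_⟩
  obtain ⟨Q, hQ, h⟩ := hP.2 I hI
  refine ⟨Q, hQ, ?_⟩
  have key : ∀ x, ∑ aI, |T x * marginal P' I x aI - T x * Q (subTuple I x) aI|
      ≤ T x * (2 * (1 - ∑ a, P x a)) := fun x => by
    simp only [← mul_sub, abs_mul, abs_of_nonneg (hT.1 x), ← Finset.mul_sum]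
    refine mul_le_mul_of_nonneg_left ?_ (hT.1 x)
    -- Both `P'` and `Q` dominate `P` on `I`, so their distance is at most the sum of two excesses,
    -- each of total mass `1 - ∑ a, P x a`.
    calc _ ≤ ∑ aI, ((marginal P' I x aI - marginal P I x aI)
          + (Q (subTuple I x) aI - marginal P I x aI)) := by
          refine Finset.sum_le_sum fun aI _ => ?_
          have h1 := marginal_mono I (hle x) aI
          have h2 := h x aI
          rw [abs_le]
          constructor <;> linarith
      _ = _ := by
          simp only [Finset.sum_add_distrib, Finset.sum_sub_distrib, sum_marginal, (hQ _).2, hsum]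
          ring
  have h1 := Finset.sum_le_sum fun x (_ : x ∈ Finset.univ) => key x
  have h2 : ∑ x, T x * (2 * (1 - ∑ a, P x a)) = 2 * (1 - ∑ x, T x * ∑ a, P x a) := by
    rw [← hT.2, mul_sub, Finset.mul_sum, Finset.mul_sum, ← Finset.sum_sub_distrib]
    exact Finset.sum_congr rfl fun x _ => by rw [hT.2]; ring
  rw [h2] at h1
  linarith

/-- With `w` the winning probability, the missing mass is at most `1 - w`. Completion does not lower
`w` and stability costs `Γ (1 - w)`, leaving `w - Γ (1 - w)`. -/
theorem MultiGame.one_sub_le_nsValue [∀ i, Nonempty (A i)] (hℓ : 1 ≤ ℓ) (G : MultiGame X A) {Γ : ℝ}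
    (hΓ : IsStabilityConstant G.T A Γ) {P : (∀ i, X i) → (∀ i, A i) → ℝ} (hP : P ∈ SNOS X A) :
    1 - (Γ + 1) * (1 - G.winProb P) ≤ G.nsValue := by
  obtain ⟨P₁, h1, h2, h3⟩ := exists_completion hℓ G.T_mem hP
  obtain ⟨P', h4, h5⟩ := hΓ.2 P₁ _ h1 h3
  have h6 := G.winProb_le_nsValue hℓ h4
  have h7 := (G.winProb_sub_le (P := P₁) (P' := P')
    fun x => by rw [(h1 x).2, sum_eq_one_of_mem_NS hℓ h4]).trans h5
  have h8 := G.winProb_le_sum hP.1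
  have h9 : G.winProb P ≤ G.winProb P₁ := by
    refine Finset.sum_le_sum fun x _ => Finset.sum_le_sum fun a _ =>
      mul_le_mul_of_nonneg_left (h2 x a) (mul_nonneg (G.T_mem.1 x) ?_)
    split_ifs <;> simp
  have h10 := mul_le_mul_of_nonneg_left (sub_le_sub_left h8 1) hΓ.1
  linarith

theorem MultiGame.nsValue_of_snosValue [∀ i, Nonempty (A i)] (hℓ : 1 ≤ ℓ) (G : MultiGame X A)
    {Γ : ℝ} (hΓ : IsStabilityConstant G.T A Γ) {ε : ℝ} (h : 1 - ε ≤ G.snosValue) :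
    1 - (Γ + 1) * ε ≤ G.nsValue := by
  have hpos : 0 < Γ + 1 := by linarith [hΓ.1]
  have hle : G.snosValue ≤ 1 - (1 - G.nsValue) / (Γ + 1) := by
    refine csSup_le ⟨_, _, zero_mem_SNOS, rfl⟩ ?_
    rintro _ ⟨P, hP, rfl⟩
    have := G.one_sub_le_nsValue hℓ hΓ hP
    rw [le_sub_comm, div_le_iff₀ hpos]
    linarith
  have h2 := h.trans hle
  rw [sub_le_sub_iff_left, div_le_iff₀ hpos] at h2
  linarith

end Values

/-! ### Analytic inequalities -/

/-- The product of nonnegative numbers is at most the corresponding power of their mean. -/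
theorem prod_le_mean_pow {K : Type*} [Fintype K] [Nonempty K] {s : K → ℝ} (hs : ∀ k, 0 ≤ s k) :
    ∏ k, s k ≤ ((∑ k, s k) / Fintype.card K) ^ Fintype.card K := by
  have hn : (Fintype.card K : ℝ) ≠ 0 := by simp
  have h := Real.geom_mean_le_arith_mean_weighted Finset.univ (fun _ : K => 1 / (Fintype.card K : ℝ))
    s (fun _ _ => by positivity) (by simp) fun k _ => hs k
  have h2 := pow_le_pow_left₀ (Finset.prod_nonneg fun k _ => Real.rpow_nonneg (hs k) _) h
    (Fintype.card K)
  rw [← Finset.prod_pow] at h2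
  calc ∏ k, s k = ∏ k, (s k ^ (1 / (Fintype.card K : ℝ))) ^ Fintype.card K := by
        refine Finset.prod_congr rfl fun k _ => ?_
        rw [← Real.rpow_mul_natCast (hs k), one_div_mul_cancel hn, Real.rpow_one]
    _ ≤ _ := h2
    _ = _ := by rw [← Finset.mul_sum, one_div, div_eq_inv_mul]

/-- The total variation distance is bounded in terms of the Bhattacharyya coefficient. -/
theorem sq_half_sum_abs_sub_le {Z : Type*} [Fintype Z] {p q : Z → ℝ} (hp : p ∈ stdSimplex ℝ Z)
    (hq : q ∈ stdSimplex ℝ Z) :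
    (1 / 2 * ∑ z, |p z - q z|) ^ 2 ≤ 1 - (∑ z, √(p z) * √(q z)) ^ 2 := by
  have e1 : ∀ z, |p z - q z| = |√(p z) - √(q z)| * (√(p z) + √(q z)) := fun z => by
    rw [← abs_of_nonneg (add_nonneg (Real.sqrt_nonneg (p z)) (Real.sqrt_nonneg (q z))), ← abs_mul]
    congr 1
    have h1 := Real.mul_self_sqrt (hp.1 z)
    have h2 := Real.mul_self_sqrt (hq.1 z)
    linear_combination h2 - h1
  -- Cauchy–Schwarz; with `F` the Bhattacharyya coefficient the two factors are `2 - 2F` and `2 +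
  -- 2F`.
  have h := Finset.sum_mul_sq_le_sq_mul_sq Finset.univ (fun z => |√(p z) - √(q z)|)
    fun z => √(p z) + √(q z)
  have h3 : ∑ z, |√(p z) - √(q z)| ^ 2 = 2 - 2 * ∑ z, √(p z) * √(q z) := by
    have : ∀ z, |√(p z) - √(q z)| ^ 2 = p z + q z - 2 * (√(p z) * √(q z)) := fun z => by
      rw [sq_abs, sub_sq, Real.sq_sqrt (hp.1 z), Real.sq_sqrt (hq.1 z)]; ring
    simp only [this, Finset.sum_sub_distrib, Finset.sum_add_distrib, hp.2, hq.2, ← Finset.mul_sum]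
    ring
  have h4 : ∑ z, (√(p z) + √(q z)) ^ 2 = 2 + 2 * ∑ z, √(p z) * √(q z) := by
    have : ∀ z, (√(p z) + √(q z)) ^ 2 = p z + q z + 2 * (√(p z) * √(q z)) := fun z => by
      rw [add_sq, Real.sq_sqrt (hp.1 z), Real.sq_sqrt (hq.1 z)]; ring
    simp only [this, Finset.sum_add_distrib, hp.2, hq.2, ← Finset.mul_sum]
    ring
  rw [h3, h4] at h
  simp only [e1]
  linarith

/-! ### Types of words -/

section Empirical

open scoped Classical in
/-- The empirical distribution of a word. -/
noncomputable def empDist {K Z : Type*} [Fintype K] (z : K → Z) (c : Z) : ℝ :=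
  (∑ k, if z k = c then 1 else 0) / Fintype.card K

variable {K Z : Type*} [Fintype K]

theorem empDist_nonneg (z : K → Z) (c : Z) : 0 ≤ empDist z c := by
  unfold empDist
  positivity

theorem empDist_apply_pos (z : K → Z) (k : K) : 0 < empDist z (z k) := by
  classical
  have : Nonempty K := ⟨k⟩
  refine div_pos (Finset.sum_pos' (fun j _ => by positivity) ⟨k, Finset.mem_univ k, by simp⟩)
    (by simp [Fintype.card_pos])

theorem sum_empDist_mul [Fintype Z] (z : K → Z) (f : Z → ℝ) :
    ∑ c, empDist z c * f c = (∑ k, f (z k)) / Fintype.card K := by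
  classical
  simp only [empDist, div_mul_eq_mul_div, ← Finset.sum_div, Finset.sum_mul]
  rw [Finset.sum_comm]
  simp

theorem empDist_mem_stdSimplex [Fintype Z] [Nonempty K] (z : K → Z) :
    empDist z ∈ stdSimplex ℝ Z := by
  refine ⟨empDist_nonneg z, ?_⟩
  simpa using sum_empDist_mul z fun _ => 1

open scoped Classical in
theorem empDist_comp [Fintype Z] {Z' : Type*} (g : Z → Z') (z : K → Z) (c' : Z') :
    empDist (fun k => g (z k)) c' = ∑ c, if g c = c' then empDist z c else 0 := by
  simpa [empDist] using (sum_empDist_mul z fun c => if g c = c' then 1 else 0).symm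

-- A type is determined by its letter counts, each between `0` and the word length, so there are
-- only polynomially many.
open scoped Classical in
theorem card_image_empDist_le [Fintype Z] {W : Type*} (s : Finset W) (w : W → K → Z) :
    (s.image fun x => empDist (w x)).card ≤ (Fintype.card K + 1) ^ Fintype.card Z := by
  have hsub : (s.image fun x => empDist (w x)) ⊆
      (Fintype.piFinset fun _ : Z => Finset.range (Fintype.card K + 1)).image
        fun N c => (N c : ℝ) / Fintype.card K := by
    intro τ hτ
    obtain ⟨x, -, rfl⟩ := Finset.mem_image.1 hτ
    refine Finset.mem_image.2 ⟨fun c => (Finset.univ.filter fun k => w x k = c).card, ?_, ?_⟩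
    · rw [Fintype.mem_piFinset]
      intro c
      rw [Finset.mem_range, Nat.lt_succ_iff]
      exact Finset.card_le_univ _
    · funext c
      simp [empDist]
  refine (Finset.card_le_card hsub).trans (Finset.card_image_le.trans ?_)
  simp [Fintype.card_piFinset]

end Empirical

/-! ### Conditional distributions and the probability of a type -/

section Conditional

variable {U B : Type*} [Fintype B] [Nonempty B]

open scoped Classical in
/-- The conditional distribution of a joint density, a point mass where the condition has
mass zero. -/
noncomputable def condDist (μ : U → B → ℝ) (u : U) : B → ℝ :=
  if ∑ b, μ u b = 0 then Pi.single (Classical.arbitrary B) 1 else fun b => μ u b / ∑ b, μ u b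

open scoped Classical in
theorem condDist_mem_stdSimplex {μ : U → B → ℝ} (hμ : ∀ u b, 0 ≤ μ u b) (u : U) :
    condDist μ u ∈ stdSimplex ℝ B := by
  unfold condDist
  split_ifs with h
  · exact single_mem_stdSimplex ℝ _
  · refine ⟨fun b => div_nonneg (hμ u b) (Finset.sum_nonneg fun b _ => hμ u b), ?_⟩
    rw [← Finset.sum_div, div_self h]

theorem condDist_mul_sum {μ : U → B → ℝ} (hμ : ∀ u b, 0 ≤ μ u b) (u : U) (b : B) :
    condDist μ u b * ∑ b, μ u b = μ u b := by
  unfold condDist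
  split_ifs with h
  · rw [h, mul_zero]
    exact ((Finset.sum_eq_zero_iff_of_nonneg fun b _ => hμ u b).1 h b (Finset.mem_univ b)).symm
  · exact div_mul_cancel₀ _ h

end Conditional

section Push

variable {X U B : Type*} [Fintype X]

open scoped Classical in
/-- The image of a joint density under a map of the first component. -/
noncomputable def pushFst (π : X → U) (τ : X → B → ℝ) (u : U) (b : B) : ℝ :=
  ∑ x, if π x = u then τ x b else 0

theorem pushFst_nonneg (π : X → U) {τ : X → B → ℝ} (hτ : ∀ x b, 0 ≤ τ x b) (u : U) (b : B) :
    0 ≤ pushFst π τ u b := by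
  classical
  exact Finset.sum_nonneg fun x _ => by split_ifs <;> simp [hτ]

variable [Fintype B]

theorem sum_sum_pushFst [Fintype U] (π : X → U) (τ : X → B → ℝ) :
    ∑ u, ∑ b, pushFst π τ u b = ∑ x, ∑ b, τ x b := by
  classical
  simp only [pushFst]
  rw [Finset.sum_comm, Finset.sum_comm (γ := X)]
  refine Finset.sum_congr rfl fun b _ => ?_
  rw [Finset.sum_comm]
  simp

variable {K : Type*} [Fintype K] [DecidableEq K] [Fintype U]

/-- A distribution on words obtained from i.i.d. letters of `U`, a channel to `B`-words, and
i.i.d. choices of preimages in `X`, has mass at most one. -/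
theorem sum_lift_le_one (π : X → U) {S : U → ℝ} (hS0 : ∀ u, 0 ≤ S u) (hS : ∑ u, S u = 1)
    {Q : (K → U) → (K → B) → ℝ} (hQ : ∀ u, Q u ∈ stdSimplex ℝ (K → B)) {W : X → B → ℝ}
    (hW0 : ∀ x b, 0 ≤ W x b) (hW : ∀ u b, pushFst π W u b ≤ 1) :
    ∑ x : K → X, ∑ b : K → B,
      (∏ k, S (π (x k))) * Q (fun k => π (x k)) b * ∏ k, W (x k) (b k) ≤ 1 := by
  classical
  -- Over a fixed image word `u`, the sum over preimages factorises into letterwise sums of `W` over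
  -- fibres of `π`, each at most one.
  rw [← Finset.sum_fiberwise Finset.univ (fun (x : K → X) (k : K) => π (x k))]
  have h1 : ∑ u : K → U, ∏ k, S (u k) = 1 := by
    rw [← Fintype.prod_sum (fun (_ : K) u => S u)]
    simp [hS]
  rw [← h1]
  refine Finset.sum_le_sum fun u _ => ?_
  rw [Finset.sum_comm]
  calc _ ≤ ∑ b : K → B, (∏ k, S (u k)) * Q u b := ?_
    _ = ∏ k, S (u k) := by rw [← Finset.mul_sum, (hQ u).2, mul_one]
  refine Finset.sum_le_sum fun b _ => ?_
  have h2 : ∑ x ∈ Finset.univ.filter (fun x : K → X => (fun k => π (x k)) = u),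
      ∏ k, W (x k) (b k) ≤ 1 := by
    have hf : Finset.univ.filter (fun x : K → X => (fun k => π (x k)) = u)
        = Fintype.piFinset fun k => Finset.univ.filter fun x => π x = u k := by
      ext x
      simp [funext_iff]
    rw [hf, ← Finset.prod_univ_sum (fun k => Finset.univ.filter fun x => π x = u k)
      fun k x => W x (b k)]
    refine Finset.prod_le_one (fun k _ => Finset.sum_nonneg fun x _ => hW0 _ _) fun k _ => ?_
    rw [Finset.sum_filter]
    exact hW (u k) (b k)
  calc _ = ∑ x ∈ Finset.univ.filter (fun x : K → X => (fun k => π (x k)) = u),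
        (∏ k, S (u k)) * Q u b * ∏ k, W (x k) (b k) := by
        refine Finset.sum_congr rfl fun x hx => ?_
        obtain rfl : (fun k => π (x k)) = u := by simpa using hx
        rfl
    _ ≤ _ := by
        rw [← Finset.mul_sum]
        exact mul_le_of_le_one_right
          (mul_nonneg (Finset.prod_nonneg fun k _ => hS0 _) ((hQ u).1 b)) h2

open scoped Classical in
/-- If the letters of a word `x` are i.i.d. and a word `b` depends only on the image of `x` under
`π`, then the probability of an empirical distribution decays exponentially in its distance from
the distributions with the same structure. -/
theorem sum_type_le [Nonempty B] [Nonempty K] (π : X → U) {T : X → ℝ} (hT : T ∈ stdSimplex ℝ X)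
    {Q : (K → U) → (K → B) → ℝ} (hQ : ∀ u, Q u ∈ stdSimplex ℝ (K → B)) {τ : X → B → ℝ}
    (z : K → X × B) (hz : ∀ x b, empDist z (x, b) = τ x b) :
    ∑ x : K → X, ∑ b : K → B, (if empDist (fun k => (x k, b k)) = empDist z then
      (∏ k, T (x k)) * Q (fun k => π (x k)) b else 0)
    ≤ (1 - (1 / 2 * ∑ x, ∑ b, |τ x b - T x * condDist (pushFst π τ) (π x) b|) ^ 2)
        ^ Fintype.card K := by
  have hτ0 : ∀ x b, 0 ≤ τ x b := fun x b => hz x b ▸ empDist_nonneg z _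
  have hτ1 : ∑ x, ∑ b, τ x b = 1 := by
    rw [← (empDist_mem_stdSimplex z).2, Fintype.sum_prod_type]
    simp only [hz]
  set μ := pushFst π τ with hμ
  have hμ0 : ∀ u b, 0 ≤ μ u b := pushFst_nonneg π hτ0
  set R := condDist μ with hR
  have hR0 := condDist_mem_stdSimplex hμ0
  set p : X × B → ℝ := fun c => τ c.1 c.2 with hp
  have hzp : empDist z = p := funext fun c => hz c.1 c.2
  set q : X × B → ℝ := fun c => T c.1 * R (π c.1) c.2 with hq
  have hpS : p ∈ stdSimplex ℝ (X × B) := ⟨fun c => hτ0 _ _, by rw [Fintype.sum_prod_type]; exact hτ1⟩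
  have hqS : q ∈ stdSimplex ℝ (X × B) := by
    refine ⟨fun c => mul_nonneg (hT.1 _) ((hR0 _).1 _), ?_⟩
    rw [Fintype.sum_prod_type]
    simp only [hq, ← Finset.mul_sum]
    rw [← hT.2]
    exact Finset.sum_congr rfl fun x _ => by rw [(hR0 (π x)).2, mul_one]
  have hBC := sq_half_sum_abs_sub_le hpS hqS
  rw [Fintype.sum_prod_type] at hBC
  set tv := 1 / 2 * ∑ x, ∑ b, |τ x b - T x * R (π x) b| with htv
  have hbase : (∑ c, √(p c) * √(q c)) ^ 2 ≤ 1 - tv ^ 2 := le_sub_comm.1 hBC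
  -- For a word of type `p`, the mean of `√(q/p)` over its letters is the Bhattacharyya coefficient
  -- of `p` and `q`, so AM–GM bounds the product of the roots by a power of it.
  have hratio : ∀ w : K → X × B, empDist w = empDist z →
      ∏ k, (q (w k) / p (w k)) ≤ (1 - tv ^ 2) ^ Fintype.card K := by
    intro w hw
    have h0 : ∀ c, 0 ≤ q c / p c := fun c => div_nonneg (hqS.1 c) (hpS.1 c)
    have h1 := prod_le_mean_pow (s := fun k => √(q (w k) / p (w k))) fun k => Real.sqrt_nonneg _
    have h2 : (∑ k, √(q (w k) / p (w k))) / Fintype.card K = ∑ c, √(p c) * √(q c) := by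
      rw [← sum_empDist_mul w fun c => √(q c / p c), hw, hzp]
      refine Finset.sum_congr rfl fun c _ => ?_
      rw [Real.sqrt_div (hqS.1 c)]
      by_cases hc : p c = 0
      · simp [hc]
      · have : √(p c) ≠ 0 := (Real.sqrt_ne_zero (hpS.1 c)).2 hc
        nth_rewrite 1 [← Real.mul_self_sqrt (hpS.1 c)]
        field_simp
    rw [h2] at h1
    calc ∏ k, (q (w k) / p (w k)) = (∏ k, √(q (w k) / p (w k))) ^ 2 := by
          rw [← Finset.prod_pow]
          exact Finset.prod_congr rfl fun k _ => (Real.sq_sqrt (h0 _)).symm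
      _ ≤ ((∑ c, √(p c) * √(q c)) ^ Fintype.card K) ^ 2 :=
          pow_le_pow_left₀ (Finset.prod_nonneg fun k _ => Real.sqrt_nonneg _) h1 2
      _ = ((∑ c, √(p c) * √(q c)) ^ 2) ^ Fintype.card K := by rw [← pow_mul, ← pow_mul, mul_comm]
      _ ≤ _ := pow_le_pow_left₀ (sq_nonneg _) hbase _
  have hbase0 : 0 ≤ 1 - tv ^ 2 := (sq_nonneg _).trans hbase
  set S : U → ℝ := fun u => ∑ b, μ u b with hS
  -- `W` is the conditional law under `τ` of `x` given `(π x, b)`. Since `0 / 0 = 0`, its mass on a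
  -- fibre may drop to zero, hence `≤ 1` below.
  set W : X → B → ℝ := fun x b => τ x b / μ (π x) b with hW
  have hW0 : ∀ x b, 0 ≤ W x b := fun x b => div_nonneg (hτ0 _ _) (hμ0 _ _)
  have hS0 : ∀ u, 0 ≤ S u := fun u => Finset.sum_nonneg fun b _ => hμ0 _ _
  have hlift := sum_lift_le_one (K := K) π hS0 (by rw [hS, hμ, sum_sum_pushFst, hτ1])
    hQ hW0 fun u b => by
      have : pushFst π W u b = μ u b / μ u b := by
        rw [hμ, pushFst, pushFst, Finset.sum_div]
        refine Finset.sum_congr rfl fun x _ => ?_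
        by_cases hx : π x = u
        · simp only [hx, if_true, hW, hμ, pushFst]
        · simp [hx]
      rw [this]
      exact div_self_le_one _
  calc _ ≤ ∑ x : K → X, ∑ b : K → B, (1 - tv ^ 2) ^ Fintype.card K *
        ((∏ k, S (π (x k))) * Q (fun k => π (x k)) b * ∏ k, W (x k) (b k)) := ?_
    _ ≤ (1 - tv ^ 2) ^ Fintype.card K := by
        simp only [← Finset.mul_sum]
        exact mul_le_of_le_one_right (pow_nonneg hbase0 _) hlift
  refine Finset.sum_le_sum fun x _ => Finset.sum_le_sum fun b _ => ?_
  have hnn : 0 ≤ (∏ k, S (π (x k))) * Q (fun k => π (x k)) b * ∏ k, W (x k) (b k) :=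
    mul_nonneg (mul_nonneg (Finset.prod_nonneg fun k _ => hS0 _) ((hQ _).1 b))
      (Finset.prod_nonneg fun k _ => hW0 _ _)
  split_ifs with h
  -- Change of measure: `τ(x,b) = S(u) R(b|u) W(x,b)` with `u = π x`, so `T = (q/p) S W`. All
  -- letters of a word of type `τ` have positive mass, which justifies the divisions.
  · have hT' : ∀ k, T (x k)
        = q (x k, b k) / p (x k, b k) * (S (π (x k)) * W (x k) (b k)) := by
      intro k
      have h1 : 0 < τ (x k) (b k) := by
        have := empDist_apply_pos (fun k => (x k, b k)) k
        rw [h, hz] at this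
        exact this
      have h2 : 0 < μ (π (x k)) (b k) := by
        refine h1.trans_le ?_
        have := Finset.single_le_sum (f := fun y => if π y = π (x k) then τ y (b k) else 0)
          (fun y _ => by split_ifs <;> simp [hτ0]) (Finset.mem_univ (x k))
        simpa [hμ, pushFst] using this
      have h3 : R (π (x k)) (b k) * S (π (x k)) = μ (π (x k)) (b k) := condDist_mul_sum hμ0 _ _
      have h4 : q (x k, b k) / p (x k, b k) * (S (π (x k)) * W (x k) (b k))
          = T (x k) * (R (π (x k)) (b k) * S (π (x k))) / μ (π (x k)) (b k) := by
        simp only [hp, hq, hW]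
        field_simp
      rw [h4, h3, mul_div_cancel_right₀ _ h2.ne']
    have h5 : (∏ k, T (x k)) * Q (fun k => π (x k)) b = (∏ k, q (x k, b k) / p (x k, b k)) *
        ((∏ k, S (π (x k))) * Q (fun k => π (x k)) b * ∏ k, W (x k) (b k)) := by
      rw [Finset.prod_congr rfl fun k _ => hT' k, Finset.prod_mul_distrib, Finset.prod_mul_distrib]
      ring
    rw [h5]
    exact mul_le_mul_of_nonneg_right (hratio _ h) hnn
  · exact mul_nonneg (pow_nonneg hbase0 _) hnn

end Push

/-! ### Distance of a type from no-signalling -/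

section Defect

variable {ℓ : ℕ} {X A : Fin ℓ → Type*} [∀ i, Fintype (A i)] [∀ i, Nonempty (A i)]

open scoped Classical in
theorem marginal_condDist_mul {τ : (∀ i, X i) → (∀ i, A i) → ℝ} (hτ0 : ∀ x a, 0 ≤ τ x a)
    (I : Finset (Fin ℓ)) (x : ∀ i, X i) (aI : ∀ i : I, A i) :
    marginal (condDist τ) I x aI * ∑ a, τ x a = marginal τ I x aI := by
  rw [marginal, Finset.sum_mul, marginal]
  refine Finset.sum_congr rfl fun a _ => ?_
  rw [ite_mul, zero_mul, condDist_mul_sum hτ0]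

variable [∀ i, Fintype (X i)]

open scoped Classical in
/-- The total variation distance of the marginal of `τ` on `(x, a_I)` from `T(x) τ(a_I | x_I)`. -/
noncomputable def signalDefect (T : (∀ i, X i) → ℝ) (τ : (∀ i, X i) → (∀ i, A i) → ℝ)
    (I : Finset (Fin ℓ)) : ℝ :=
  1 / 2 * ∑ x, ∑ aI, |marginal τ I x aI
    - T x * condDist (pushFst (subTuple I) (marginal τ I)) (subTuple I x) aI|

theorem sum_abs_fst_sub_le (T : (∀ i, X i) → ℝ) {τ : (∀ i, X i) → (∀ i, A i) → ℝ}
    (hτ0 : ∀ x a, 0 ≤ τ x a) (I : Finset (Fin ℓ)) :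
    1 / 2 * ∑ x, |∑ a, τ x a - T x| ≤ signalDefect T τ I := by
  refine mul_le_mul_of_nonneg_left (Finset.sum_le_sum fun x _ => ?_) (by norm_num)
  refine le_trans (le_of_eq ?_) (Finset.abs_sum_le_sum_abs _ _)
  rw [Finset.sum_sub_distrib, sum_marginal, ← Finset.mul_sum,
    (condDist_mem_stdSimplex (pushFst_nonneg _ fun x => marginal_nonneg I (hτ0 x)) _).2, mul_one]

theorem signalDefect_le_one {T : (∀ i, X i) → ℝ} (hT : T ∈ stdSimplex ℝ (∀ i, X i))
    {τ : (∀ i, X i) → (∀ i, A i) → ℝ} (hτ0 : ∀ x a, 0 ≤ τ x a) (hτ1 : ∑ x, ∑ a, τ x a = 1)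
    (I : Finset (Fin ℓ)) : signalDefect T τ I ≤ 1 := by
  have hR : ∀ u, condDist (pushFst (subTuple I) (marginal τ I)) u ∈ stdSimplex ℝ _ :=
    condDist_mem_stdSimplex (pushFst_nonneg _ fun x => marginal_nonneg I (hτ0 x))
  have key : ∀ x, ∑ aI, |marginal τ I x aI
      - T x * condDist (pushFst (subTuple I) (marginal τ I)) (subTuple I x) aI|
      ≤ ∑ a, τ x a + T x := fun x => by
    have h0 : T x = ∑ aI, T x * condDist (pushFst (subTuple I) (marginal τ I)) (subTuple I x) aI := by
      rw [← Finset.mul_sum, (hR _).2, mul_one]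
    rw [← sum_marginal τ I x]
    nth_rewrite 2 [h0]
    rw [← Finset.sum_add_distrib]
    refine Finset.sum_le_sum fun aI _ => ?_
    have h1 := marginal_nonneg I (hτ0 x) aI
    have h2 := mul_nonneg (hT.1 x) ((hR (subTuple I x)).1 aI)
    rw [abs_le]
    constructor <;> linarith
  have h := Finset.sum_le_sum fun x (_ : x ∈ Finset.univ) => key x
  rw [Finset.sum_add_distrib, hτ1, hT.2] at h
  unfold signalDefect
  linarith

/-- One `e` is the defect itself; the other pays for replacing the query marginal of `τ` by `T`, a
distance the defect also controls. -/
theorem isApproxNS_condDist {T : (∀ i, X i) → ℝ} {τ : (∀ i, X i) → (∀ i, A i) → ℝ}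
    (hτ0 : ∀ x a, 0 ≤ τ x a) {e : ℝ} (h : ∀ I, I ⊂ Finset.univ → signalDefect T τ I ≤ e) :
    IsApproxNS T (condDist τ) (2 * e) := by
  intro I hI
  refine ⟨condDist (pushFst (subTuple I) (marginal τ I)),
    condDist_mem_stdSimplex (pushFst_nonneg _ fun x => marginal_nonneg I (hτ0 x)), ?_⟩
  set R := condDist (pushFst (subTuple I) (marginal τ I)) with hR
  have h1 := sum_abs_fst_sub_le T hτ0 I
  have h2 := h I hI
  have hP : ∀ x a, 0 ≤ condDist τ x a := fun x => (condDist_mem_stdSimplex hτ0 x).1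
  have key : ∀ x, ∑ aI, |T x * marginal (condDist τ) I x aI - T x * R (subTuple I x) aI|
      ≤ |∑ a, τ x a - T x| + ∑ aI, |marginal τ I x aI - T x * R (subTuple I x) aI| := by
    intro x
    calc _ ≤ ∑ aI, (|∑ a, τ x a - T x| * marginal (condDist τ) I x aI
          + |marginal τ I x aI - T x * R (subTuple I x) aI|) := by
          refine Finset.sum_le_sum fun aI _ => ?_
          refine (abs_sub_le _ (marginal τ I x aI) _).trans (add_le_add_left (le_of_eq ?_) _)
          rw [← marginal_condDist_mul hτ0, abs_sub_comm, mul_comm (T x), ← mul_sub, abs_mul,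
            abs_of_nonneg (marginal_nonneg I (hP x) aI), mul_comm]
      _ = _ := by
          rw [Finset.sum_add_distrib, ← Finset.mul_sum, sum_marginal,
            (condDist_mem_stdSimplex hτ0 x).2, mul_one]
  have h3 := Finset.sum_le_sum fun x (_ : x ∈ Finset.univ) => key x
  rw [Finset.sum_add_distrib] at h3
  unfold signalDefect at h1 h2
  linarith

/-- A distribution that is close to satisfying all no-signalling constraints wins hardly more often
than no-signalling strategies do. -/
theorem MultiGame.win_le_of_signalDefect_le (hℓ : 1 ≤ ℓ) (G : MultiGame X A) {Γ : ℝ}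
    (hΓ : IsStabilityConstant G.T A Γ) {τ : (∀ i, X i) → (∀ i, A i) → ℝ}
    (hτ0 : ∀ x a, 0 ≤ τ x a) (hτ1 : ∑ x, ∑ a, τ x a = 1) {e : ℝ}
    (h : ∀ I, I ⊂ Finset.univ → signalDefect G.T τ I ≤ e) :
    ∑ x, ∑ a, (if G.V a x = true then 1 else 0) * τ x a ≤ G.nsValue + (2 * Γ + 1) * e := by
  have hP := condDist_mem_stdSimplex hτ0
  obtain ⟨P', hP', h1⟩ := hΓ.2 _ _ hP (isApproxNS_condDist hτ0 h)
  have h2 := G.winProb_le_nsValue hℓ hP'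
  have h3 := (G.winProb_sub_le (P := condDist τ) (P' := P')
    fun x => by rw [(hP x).2, sum_eq_one_of_mem_NS hℓ hP']).trans h1
  -- Stability accounts for `2 Γ e`; the additional `e` is the cost of passing from `τ` to `T` times
  -- its conditional, bounded below by the defect at `I = ∅`.
  have h4 : ∑ x, ∑ a, (if G.V a x = true then 1 else 0) * τ x a - G.winProb (condDist τ)
      ≤ 1 / 2 * ∑ x, |∑ a, τ x a - G.T x| := by
    have := sum_mul_sub_le_half_sum_abs (Z := (∀ i, X i) × (∀ i, A i))
      (f := fun z => if G.V z.2 z.1 = true then 1 else 0) (p := fun z => τ z.1 z.2)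
      (q := fun z => G.T z.1 * condDist τ z.1 z.2) (fun z => by split_ifs <;> simp)
      (fun z => by split_ifs <;> simp) (by
        simp only [Fintype.sum_prod_type, ← Finset.mul_sum, (hP _).2, mul_one, hτ1, G.T_mem.2])
    simp only [Fintype.sum_prod_type] at this
    have e1 : ∀ x, ∑ a, |τ x a - G.T x * condDist τ x a| = |∑ a, τ x a - G.T x| := fun x => by
      have : ∀ a, |τ x a - G.T x * condDist τ x a|
          = |∑ a, τ x a - G.T x| * condDist τ x a := fun a => by
        nth_rewrite 1 [← condDist_mul_sum hτ0 x a]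
        rw [mul_comm (G.T x), ← mul_sub, abs_mul, abs_of_nonneg ((hP x).1 a), mul_comm]
      simp only [this, ← Finset.mul_sum, (hP x).2, mul_one]
    simp only [e1] at this
    refine le_trans (le_of_eq ?_) this
    unfold winProb
    rw [← Finset.sum_sub_distrib]
    refine Finset.sum_congr rfl fun x _ => ?_
    rw [← Finset.sum_sub_distrib]
    refine Finset.sum_congr rfl fun a _ => ?_
    ring
  have : Nonempty (Fin ℓ) := ⟨⟨0, hℓ⟩⟩
  have hI : (∅ : Finset (Fin ℓ)) ⊂ Finset.univ := Finset.empty_ssubset.2 Finset.univ_nonempty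
  have h5 := (sum_abs_fst_sub_le G.T hτ0 ∅).trans (h ∅ hI)
  linarith

end Defect

/-! ### Types under a no-signalling strategy on words -/

section Words

variable {ℓ : ℕ} {X A : Fin ℓ → Type*} [∀ i, Fintype (X i)] [∀ i, Fintype (A i)]

theorem sum_words_eq {ι K : Type*} [Fintype ι] [DecidableEq ι] [Fintype K] [DecidableEq K]
    {Y : ι → Type*} [∀ i, Fintype (Y i)] (F : (∀ i, K → Y i) → ℝ) :
    ∑ x : ∀ i, K → Y i, F x = ∑ x : K → ∀ i, Y i, F fun i k => x k i :=
  Fintype.sum_equiv (Equiv.piComm fun (i : ι) (_ : K) => Y i) _ _ fun _ => rfl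

open scoped Classical in
/-- The probability of an empirical distribution, when the queries are i.i.d. and the answers are
given by a no-signalling correlation on words. -/
theorem sum_empDist_le_of_mem_NS [∀ i, Nonempty (A i)] {K : Type*} [Fintype K] [DecidableEq K]
    [Nonempty K] {T : (∀ i, X i) → ℝ} (hT : T ∈ stdSimplex ℝ (∀ i, X i))
    {P : (∀ i, K → X i) → (∀ i, K → A i) → ℝ}
    (hP : P ∈ NS (fun i => K → X i) (fun i => K → A i)) {I : Finset (Fin ℓ)}
    (hI : I ⊂ Finset.univ) (z : K → (∀ i, X i) × (∀ i, A i)) :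
    ∑ x : ∀ i, K → X i, ∑ a : ∀ i, K → A i,
      (if empDist (fun k => ((fun i => x i k, fun i => a i k) : (∀ i, X i) × (∀ i, A i)))
        = empDist z then (∏ k, T fun i => x i k) * P x a else 0)
    ≤ (1 - signalDefect T (fun x a => empDist z (x, a)) I ^ 2) ^ Fintype.card K := by
  obtain ⟨Q, hQ, h⟩ := hP.2 I hI
  set τ : (∀ i, X i) → (∀ i, A i) → ℝ := fun x a => empDist z (x, a) with hτ
  let g : (∀ i, X i) × (∀ i, A i) → (∀ i, X i) × (∀ i : I, A i) := fun c => (c.1, subTuple I c.2)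
  have hz : ∀ x aI, empDist (fun k => g (z k)) (x, aI) = marginal τ I x aI := by
    intro x aI
    rw [empDist_comp, Fintype.sum_prod_type, marginal]
    simp only [g, Prod.mk.injEq, hτ]
    rw [Finset.sum_eq_single x (fun y _ hy => by simp [hy]) (by simp)]
    simp
  have hQ' : ∀ u : K → ∀ i : I, X i, (fun b : K → ∀ i : I, A i =>
      Q (fun i k => u k i) fun i k => b k i) ∈ stdSimplex ℝ (K → ∀ i : I, A i) := fun u => by
    refine ⟨fun b => (hQ _).1 _, ?_⟩
    rw [← (hQ fun i k => u k i).2, sum_words_eq]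
  refine le_trans ?_ (sum_type_le (subTuple I) hT hQ' (fun k => g (z k)) hz)
  rw [sum_words_eq]
  refine Finset.sum_le_sum fun x _ => ?_
  rw [← sum_words_eq fun aI : ∀ i : I, K → A i =>
    if empDist (fun k => ((x k, fun i => aI i k) : (∀ i, X i) × (∀ i : I, A i)))
        = empDist (fun k => g (z k)) then
      (∏ k, T (x k)) * Q (fun i k => subTuple I (x k) i) aI else 0]
  have hm : ∀ aI, Q (fun i k => subTuple I (x k) i) aI = marginal P I (fun i k => x k i) aI :=
    fun aI => (h (fun i k => x k i) aI).symm
  have e := sum_mul_marginal P I (fun i k => x k i) fun aI : ∀ i : I, K → A i =>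
    if empDist (fun k => ((x k, fun i => aI i k) : (∀ i, X i) × (∀ i : I, A i)))
        = empDist (fun k => g (z k)) then ∏ k, T (x k) else 0
  simp only [ite_mul, zero_mul] at e
  simp only [hm]
  rw [e]
  refine Finset.sum_le_sum fun a _ => ?_
  have hnn : 0 ≤ (∏ k, T (x k)) * P (fun i k => x k i) a :=
    mul_nonneg (Finset.prod_nonneg fun k _ => hT.1 _) (hP.1 _ _)
  -- The type of `(x, a)` determines that of `(x, a_I)`. The enlarged event involves `P` only
  -- through its marginal on `I`, that is, through `Q`.
  by_cases hc : empDist (fun k => ((fun i => x k i, fun i => a i k) : (∀ i, X i) × (∀ i, A i)))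
      = empDist z
  · have hc' : empDist (fun k => ((x k, fun i => subTuple I a i k) :
        (∀ i, X i) × (∀ i : I, A i))) = empDist (fun k => g (z k)) := by
      funext c
      have h1 := empDist_comp g z c
      rw [← hc, ← empDist_comp] at h1
      exact h1.symm
    rw [if_pos hc, if_pos hc']
  · rw [if_neg hc]
    split_ifs <;> simp [hnn]

/-- The probability of winning at least `t` of the rounds indexed by `K`. -/
def MultiGame.thresholdWin (G : MultiGame X A) (K : Type*) [Fintype K] [DecidableEq K] (t : ℕ)
    (P : (∀ i, K → X i) → (∀ i, K → A i) → ℝ) : ℝ :=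
  ∑ x : ∀ i, K → X i, ∑ a : ∀ i, K → A i, (∏ k, G.T fun i => x i k) *
    (if t ≤ (Finset.univ.filter fun k => G.V (fun i => a i k) (fun i => x i k) = true).card
      then 1 else 0) * P x a

open scoped Classical in
theorem MultiGame.thresholdWin_le_poly_mul [∀ i, Nonempty (A i)] (hℓ : 1 ≤ ℓ) (G : MultiGame X A)
    {Γ : ℝ} (hΓ : IsStabilityConstant G.T A Γ) {δ α : ℝ} (hδ : G.nsValue ≤ 1 - δ) (hα : 0 < α)
    (hα1 : α ≤ 1) {K : Type*} [Fintype K] [DecidableEq K] [Nonempty K] {t : ℕ}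
    (ht : (1 - δ + α) * Fintype.card K ≤ t) {P : (∀ i, K → X i) → (∀ i, K → A i) → ℝ}
    (hP : P ∈ NS (fun i => K → X i) (fun i => K → A i)) :
    G.thresholdWin K t P ≤
      (Fintype.card K + 1 : ℝ) ^ Fintype.card ((∀ i, X i) × (∀ i, A i)) *
        (1 - α ^ 2 / (4 * (Γ + 1) ^ 2)) ^ Fintype.card K := by
  have hΓ0 := hΓ.1
  have hK : (0 : ℝ) < Fintype.card K := by simp [Fintype.card_pos]
  set β := (1 - α ^ 2 / (4 * (Γ + 1) ^ 2)) ^ Fintype.card K with hβ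
  have hβ0 : 0 ≤ β := by
    refine pow_nonneg (sub_nonneg.2 ((div_le_one (by positivity)).2 ?_)) _
    nlinarith
  let w : (∀ i, K → X i) × (∀ i, K → A i) → K → (∀ i, X i) × (∀ i, A i) :=
    fun z k => (fun i => z.1 i k, fun i => z.2 i k)
  let f : (∀ i, K → X i) × (∀ i, K → A i) → ℝ := fun z => (∏ k, G.T fun i => z.1 i k) * P z.1 z.2
  have hf : ∀ z, 0 ≤ f z := fun z =>
    mul_nonneg (Finset.prod_nonneg fun k _ => G.T_mem.1 _) (hP.1 _ _)
  set s := Finset.univ.filter fun z : (∀ i, K → X i) × (∀ i, K → A i) => t ≤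
    (Finset.univ.filter fun k => G.V (fun i => z.2 i k) (fun i => z.1 i k) = true).card with hs
  have e1 : G.thresholdWin K t P = ∑ z ∈ s, f z := by
    rw [thresholdWin, hs, Finset.sum_filter, Fintype.sum_prod_type]
    refine Finset.sum_congr rfl fun x _ => Finset.sum_congr rfl fun a _ => ?_
    split_ifs <;> simp [f]
  rw [e1, ← Finset.sum_fiberwise_of_maps_to (t := s.image fun z => empDist (w z))
    fun z hz => Finset.mem_image_of_mem _ hz]
  refine (Finset.sum_le_card_nsmul _ _ β fun τ hτ => ?_).trans ?_
  · obtain ⟨z, hz, rfl⟩ := Finset.mem_image.1 hτ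
    have hwin : 1 - δ + α ≤ ∑ x, ∑ a, (if G.V a x = true then 1 else 0) * empDist (w z) (x, a) := by
      have h1 := sum_empDist_mul (w z) fun c => if G.V c.2 c.1 = true then 1 else 0
      rw [Fintype.sum_prod_type] at h1
      simp only [mul_comm (empDist _ _)] at h1
      rw [h1, le_div_iff₀ hK]
      refine ht.trans ?_
      rw [Finset.sum_boole]
      exact_mod_cast (Finset.mem_filter.1 hz).2
    -- The threshold is chosen so that `(2Γ + 1) e < α`: were all defects at most `e`, the type
    -- would win less than `1 - δ + α`.
    have hex : ∃ I, I ⊂ Finset.univ ∧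
        α / (2 * (Γ + 1)) < signalDefect G.T (fun x a => empDist (w z) (x, a)) I := by
      by_contra! hcon
      have h2 := G.win_le_of_signalDefect_le hℓ hΓ (fun x a => empDist_nonneg (w z) (x, a))
        (by rw [← (empDist_mem_stdSimplex (w z)).2, Fintype.sum_prod_type]) hcon
      have h3 : (2 * Γ + 1) * (α / (2 * (Γ + 1))) < α := by
        rw [mul_div_assoc', div_lt_iff₀ (by positivity)]
        nlinarith
      linarith
    obtain ⟨I, hI, hIα⟩ := hex
    have h4 := sum_empDist_le_of_mem_NS G.T_mem hP hI (w z)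
    calc ∑ y ∈ s with empDist (w y) = empDist (w z), f y
        ≤ ∑ y with empDist (w y) = empDist (w z), f y :=
          Finset.sum_le_sum_of_subset_of_nonneg
            (Finset.filter_subset_filter _ (Finset.subset_univ _)) fun y _ _ => hf y
      _ ≤ (1 - signalDefect G.T (fun x a => empDist (w z) (x, a)) I ^ 2) ^ Fintype.card K := by
          rw [Finset.sum_filter, Fintype.sum_prod_type]
          exact h4
      _ ≤ β := by
          have h5 : 0 < α / (2 * (Γ + 1)) := by positivity
          have h6 := signalDefect_le_one G.T_mem (fun x a => empDist_nonneg (w z) (x, a))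
            (by rw [← (empDist_mem_stdSimplex (w z)).2, Fintype.sum_prod_type]) I
          have h7 : α ^ 2 / (4 * (Γ + 1) ^ 2) = (α / (2 * (Γ + 1))) ^ 2 := by
            rw [div_pow, mul_pow]; norm_num
          rw [hβ, h7]
          refine pow_le_pow_left₀ (sub_nonneg.2 (pow_le_one₀ (h5.le.trans hIα.le) h6)) ?_ _
          exact sub_le_sub_left (pow_le_pow_left₀ h5.le hIα.le 2) 1
  · rw [nsmul_eq_mul]
    refine mul_le_mul_of_nonneg_right ?_ hβ0
    exact_mod_cast card_image_empDist_le s w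

end Words

/-! ### Independent copies and removal of polynomial factors -/

section Tensor

variable {M N : Type*} [Fintype M] [DecidableEq M] [Fintype N] [DecidableEq N]

theorem sum_prod_blocks {ι : Type*} [Fintype ι] [DecidableEq ι] {Y : ι → Type*}
    [∀ i, Fintype (Y i)] (F : M → (∀ i, N → Y i) → ℝ) :
    ∑ x : ∀ i, M × N → Y i, ∏ j, F j (fun i k => x i (j, k)) = ∏ j, ∑ x, F j x := by
  rw [Fintype.prod_sum]
  exact Fintype.sum_equiv
    ⟨fun x j i k => x i (j, k), fun y i p => y p.1 i p.2, fun _ => rfl, fun _ => rfl⟩ _ _ fun _ => rfl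

variable {ℓ : ℕ} {X A : Fin ℓ → Type*} [∀ i, Fintype (A i)]

/-- Independent uses of a correlation on blocks of rounds. -/
def blockPower (M : Type*) [Fintype M] {N : Type*} (P : (∀ i, N → X i) → (∀ i, N → A i) → ℝ)
    (x : ∀ i, M × N → X i) (a : ∀ i, M × N → A i) : ℝ :=
  ∏ j, P (fun i k => x i (j, k)) (fun i k => a i (j, k))

theorem marginal_eq_sum_indicator (P : (∀ i, X i) → (∀ i, A i) → ℝ) (I : Finset (Fin ℓ))
    (x : ∀ i, X i) (aI : ∀ i : I, A i) :
    marginal P I x aI = ∑ a, {a | subTuple I a = aI}.indicator (P x) a := by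
  classical
  refine Finset.sum_congr rfl fun a _ => ?_
  rw [Set.indicator_apply]
  congr

/-- Fixing the answers of `I` is a condition on each block separately, so the marginal is the
product of the block marginals. -/
theorem blockPower_mem_NS {P : (∀ i, N → X i) → (∀ i, N → A i) → ℝ}
    (hP : P ∈ NS (fun i => N → X i) (fun i => N → A i)) :
    blockPower M P ∈ NS (fun i => M × N → X i) (fun i => M × N → A i) := by
  classical
  refine ⟨fun x a => Finset.prod_nonneg fun j _ => hP.1 _ _, fun I hI => ?_⟩
  obtain ⟨Q, hQ, h⟩ := hP.2 I hI
  refine ⟨fun xI aI => ∏ j, Q (fun i k => xI i (j, k)) (fun i k => aI i (j, k)), fun xI =>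
    ⟨fun aI => Finset.prod_nonneg fun j _ => (hQ _).1 _, ?_⟩, fun x aI => ?_⟩
  · rw [sum_prod_blocks fun j aI => Q (fun i k => xI i (j, k)) aI]
    exact Finset.prod_eq_one fun j _ => (hQ _).2
  · have e : ∀ a : ∀ i, M × N → A i,
        {a | subTuple I a = aI}.indicator (blockPower M P x) a
          = ∏ j, {b : ∀ i, N → A i | subTuple I b = fun i k => aI i (j, k)}.indicator
            (P fun i k => x i (j, k)) (fun i k => a i (j, k)) := by
      intro a
      by_cases ha : subTuple I a = aI
      · rw [Set.indicator_of_mem (by exact ha)]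
        refine Finset.prod_congr rfl fun j _ => (Set.indicator_of_mem ?_ _).symm
        subst ha
        rfl
      · rw [Set.indicator_of_notMem (by exact ha)]
        obtain ⟨i, hi⟩ := Function.ne_iff.1 ha
        obtain ⟨⟨j, k⟩, hjk⟩ := Function.ne_iff.1 hi
        refine (Finset.prod_eq_zero (Finset.mem_univ j) (Set.indicator_of_notMem ?_ _)).symm
        exact fun h => hjk (congrFun (congrFun h i) k)
    rw [marginal_eq_sum_indicator, Finset.sum_congr rfl fun a _ => e a,
      sum_prod_blocks fun j => {b : ∀ i, N → A i | subTuple I b = fun i k => aI i (j, k)}.indicator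
        (P fun i k => x i (j, k))]
    refine Finset.prod_congr rfl fun j _ => ?_
    rw [← marginal_eq_sum_indicator, h]
    rfl

/-- Winning `t` rounds in every block wins at least `|M| t` rounds in all, and the threshold
fraction is unchanged. -/
theorem MultiGame.thresholdWin_pow_le [∀ i, Fintype (X i)] (G : MultiGame X A) (t : ℕ)
    {P : (∀ i, N → X i) → (∀ i, N → A i) → ℝ} (hP : ∀ x a, 0 ≤ P x a) :
    G.thresholdWin N t P ^ Fintype.card M
      ≤ G.thresholdWin (M × N) (Fintype.card M * t) (blockPower M P) := by
  let F : (∀ i, N → X i) → (∀ i, N → A i) → ℝ := fun x a => (∏ k, G.T fun i => x i k) *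
    (if t ≤ (Finset.univ.filter fun k => G.V (fun i => a i k) (fun i => x i k) = true).card
      then 1 else 0) * P x a
  have e : G.thresholdWin N t P ^ Fintype.card M = ∑ x : ∀ i, M × N → X i,
      ∑ a : ∀ i, M × N → A i, ∏ j, F (fun i k => x i (j, k)) (fun i k => a i (j, k)) := by
    calc _ = ∏ _j : M, ∑ x, ∑ a, F x a := by rw [Finset.prod_const, Finset.card_univ]; rfl
      _ = ∑ x : ∀ i, M × N → X i, ∏ j, ∑ a, F (fun i k => x i (j, k)) a :=
          (sum_prod_blocks fun _ x => ∑ a, F x a).symm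
      _ = _ := Finset.sum_congr rfl fun x _ =>
          (sum_prod_blocks fun j a => F (fun i k => x i (j, k)) a).symm
  rw [e]
  refine Finset.sum_le_sum fun x _ => Finset.sum_le_sum fun a _ => ?_
  simp only [F]
  rw [Finset.prod_mul_distrib, Finset.prod_mul_distrib, Fintype.prod_prod_type]
  refine mul_le_mul_of_nonneg_right (mul_le_mul_of_nonneg_left ?_
    (Finset.prod_nonneg fun j _ => Finset.prod_nonneg fun k _ => G.T_mem.1 _))
    (Finset.prod_nonneg fun j _ => hP _ _)
  rw [Fintype.prod_ite_zero]
  split_ifs with h1 h2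
  · simp
  · refine absurd ?_ h2
    rw [Finset.card_filter, Fintype.sum_prod_type, ← smul_eq_mul, ← Finset.card_univ]
    refine Finset.card_nsmul_le_sum _ _ _ fun j _ => ?_
    rw [← Finset.card_filter]
    exact h1 j
  · exact zero_le_one
  · exact le_rfl

end Tensor

/-- Polynomial factors in bounds on all powers of a number may be dropped. -/
theorem le_of_forall_pow_le_poly_mul {v b : ℝ} (hb : 0 ≤ b) (n d : ℕ)
    (h : ∀ m : ℕ, 0 < m → v ^ m ≤ ((m * n : ℕ) + 1 : ℝ) ^ d * b ^ m) : v ≤ b := by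
  by_contra! hlt
  have hv : 0 < v := hb.trans_lt hlt
  have hr : |b / v| < 1 := by
    rw [abs_of_nonneg (div_nonneg hb hv.le), div_lt_one hv]
    exact hlt
  -- If `b < v`, then `m ^ d * (b / v) ^ m` tends to zero, contradicting the hypothesis for large
  -- `m`.
  have hlim := (tendsto_pow_const_mul_const_pow_of_abs_lt_one d hr).const_mul ((n + 1 : ℝ) ^ d)
  rw [mul_zero] at hlim
  obtain ⟨m, hm, hm0⟩ := ((hlim.eventually_lt_const one_pos).and
    (Filter.eventually_gt_atTop 0)).exists
  have h1 := h m hm0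
  have hm1 : (1 : ℝ) ≤ m := by exact_mod_cast hm0
  have h2 : ((m * n : ℕ) + 1 : ℝ) ^ d ≤ (n + 1 : ℝ) ^ d * (m : ℝ) ^ d := by
    rw [← mul_pow]
    refine pow_le_pow_left₀ (by positivity) ?_ d
    push_cast
    linarith
  have h3 : v ^ m ≤ (n + 1 : ℝ) ^ d * (m : ℝ) ^ d * b ^ m :=
    h1.trans (mul_le_mul_of_nonneg_right h2 (by positivity))
  rw [div_pow, mul_div_assoc', mul_div_assoc', div_lt_one (by positivity)] at hm
  linarith

theorem MultiGame.parallel_eq_threshold {ℓ : ℕ} {X A : Fin ℓ → Type*} [∀ i, Fintype (X i)]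
    (G : MultiGame X A) (n : ℕ) :
    G.parallel n = G.threshold n n := by
  simp only [parallel, threshold, MultiGame.mk.injEq, true_and]
  funext a x
  rw [decide_eq_decide]
  constructor
  · intro h
    simp [h]
  · intro h k
    have h1 := Finset.eq_univ_of_card _ (le_antisymm (Finset.card_le_univ _)
      ((Fintype.card_fin n).le.trans h))
    exact (Finset.mem_filter.1 (Finset.eq_univ_iff_forall.1 h1 k)).2

/-! ### The repeated game and the theorem -/

section Concentration

variable {ℓ : ℕ} {X A : Fin ℓ → Type*} [∀ i, Fintype (X i)] [∀ i, Fintype (A i)]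

theorem MultiGame.winProb_threshold (G : MultiGame X A) (t n : ℕ)
    (P : (∀ i, Fin n → X i) → (∀ i, Fin n → A i) → ℝ) :
    (G.threshold t n).winProb P = G.thresholdWin (Fin n) t P := by
  refine Finset.sum_congr rfl fun x _ => Finset.sum_congr rfl fun a _ => ?_
  simp only [threshold, decide_eq_true_eq]
  rfl

/-- The threshold value of the repeated game is exponentially small above the no-signalling
value. -/
theorem MultiGame.nsValue_threshold_le [∀ i, Nonempty (A i)] (hℓ : 1 ≤ ℓ) (G : MultiGame X A)
    {Γ : ℝ} (hΓ : IsStabilityConstant G.T A Γ) {δ α : ℝ} (hδ : G.nsValue ≤ 1 - δ) (hα : 0 < α)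
    (hα1 : α ≤ 1) {n t : ℕ} (ht : (1 - δ + α) * n ≤ t) :
    (G.threshold t n).nsValue ≤ (1 - α ^ 2 / (4 * (Γ + 1) ^ 2)) ^ n := by
  have hΓ0 := hΓ.1
  have hβ0 : 0 ≤ 1 - α ^ 2 / (4 * (Γ + 1) ^ 2) :=
    sub_nonneg.2 ((div_le_one (by positivity)).2 (by nlinarith))
  refine Real.sSup_le ?_ (pow_nonneg hβ0 n)
  rintro _ ⟨P, hP, rfl⟩
  rcases Nat.eq_zero_or_pos n with rfl | hn
  · simpa using (G.threshold t 0).winProb_le_one hℓ (NS_subset_SNOS hP)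
  have : Nonempty (Fin n) := ⟨⟨0, hn⟩⟩
  rw [winProb_threshold]
  -- The type bound is applied to `m` independent copies, on `m * n` rounds, for every `m`; the
  -- exponent of the polynomial does not depend on `m`.
  refine le_of_forall_pow_le_poly_mul (pow_nonneg hβ0 n) n
    (Fintype.card ((∀ i, X i) × (∀ i, A i))) fun m hm => ?_
  have : Nonempty (Fin m) := ⟨⟨0, hm⟩⟩
  have h1 := G.thresholdWin_pow_le (M := Fin m) t hP.1
  have h2 := G.thresholdWin_le_poly_mul hℓ hΓ hδ hα hα1 (K := Fin m × Fin n)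
    (t := Fintype.card (Fin m) * t) (by
      simp only [Fintype.card_prod, Fintype.card_fin]
      push_cast
      calc (1 - δ + α) * (m * n) = m * ((1 - δ + α) * n) := by ring
        _ ≤ m * t := mul_le_mul_of_nonneg_left ht (by positivity)) (blockPower_mem_NS hP)
  rw [Fintype.card_prod, Fintype.card_fin, Fintype.card_fin] at h2
  rw [Fintype.card_fin] at h1
  rw [← pow_mul, mul_comm n m]
  exact h1.trans h2

end Concentration

theorem one_le_playerConst {ℓ : ℕ} (hℓ : 1 ≤ ℓ) : 1 ≤ playerConst ℓ := by
  have : (2 : ℝ) ^ 2 ≤ 2 ^ (ℓ + 1) := pow_le_pow_right₀ one_le_two (by omega)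
  unfold playerConst
  linarith

theorem corollary2 {ℓ : ℕ} (hℓ : 1 ≤ ℓ) (X : Fin ℓ → Type u) [∀ i, Fintype (X i)]
    (T : (∀ i, X i) → ℝ) (hT : T ∈ stdSimplex ℝ (∀ i, X i)) (hfull : ∀ x, 0 < T x) :
    -- a stability constant exists that depends only on `T`, not on the answer alphabets
    (∃ Γ : ℝ, ∀ (A : Fin ℓ → Type v) [∀ i, Fintype (A i)] [∀ i, Nonempty (A i)],
      IsStabilityConstant T A Γ) ∧
    -- every stability constant relates the two values and gives the rates
    ∀ (A : Fin ℓ → Type v) [∀ i, Fintype (A i)] [∀ i, Nonempty (A i)] (Γ : ℝ),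
      IsStabilityConstant T A Γ →
      ∀ G : MultiGame X A, G.T = T →
        (∀ ε : ℝ, 1 - ε ≤ G.snosValue → 1 - (Γ + 1) * ε ≤ G.nsValue) ∧
        ∀ δ : ℝ, 0 < δ → δ < 1 → G.nsValue ≤ 1 - δ →
          ∀ n : ℕ,
            (G.parallel n).nsValue
                ≤ (1 - δ ^ 2 / (5 * playerConst ℓ ^ 2 * (Γ + 1) ^ 2)) ^ n ∧
            ∀ (α : ℝ) (t : ℕ), 0 < α → α ≤ δ → (1 - δ + α) * n ≤ t →
              (G.threshold t n).nsValue
                ≤ Real.exp (-(n * (α ^ 2 / (5 * playerConst ℓ ^ 2 * (Γ + 1) ^ 2)))) := by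
  refine ⟨exists_isStabilityConstant hℓ hT hfull, ?_⟩
  rintro A _ _ Γ hΓ G rfl
  refine ⟨fun ε h => G.nsValue_of_snosValue hℓ hΓ h, fun δ hδ0 hδ1 hδ n => ?_⟩
  have hΓ0 := hΓ.1
  have hC := one_le_playerConst hℓ
  have key : ∀ (α : ℝ) (t : ℕ), 0 < α → α ≤ δ → (1 - δ + α) * n ≤ t →
      (G.threshold t n).nsValue
        ≤ (1 - α ^ 2 / (5 * playerConst ℓ ^ 2 * (Γ + 1) ^ 2)) ^ n := by
    intro α t hα0 hα ht
    refine (G.nsValue_threshold_le hℓ hΓ hδ hα0 (hα.trans hδ1.le) ht).trans ?_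
    refine pow_le_pow_left₀ (sub_nonneg.2 ((div_le_one (by positivity)).2 (by nlinarith))) ?_ n
    -- The rate already proved has `4` in place of `5 C_ℓ²`, so `C_ℓ ≥ 1` suffices.
    have hC2 : 1 ≤ playerConst ℓ ^ 2 := one_le_pow₀ hC
    gcongr
    linarith
  refine ⟨?_, fun α t hα0 hα ht => ?_⟩
  -- Winning all rounds is the case `α = δ`, `t = n`.
  · rw [G.parallel_eq_threshold]
    exact key δ n hδ0 le_rfl (by linarith)
  · refine (key α t hα0 hα ht).trans ?_
    rw [← mul_neg, Real.exp_nat_mul]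
    refine pow_le_pow_left₀ (sub_nonneg.2 ((div_le_one (by positivity)).2 ?_))
      (Real.one_sub_le_exp_neg _) n
    have h1 : 1 ≤ playerConst ℓ ^ 2 * (Γ + 1) ^ 2 :=
      one_le_mul_of_one_le_of_one_le (one_le_pow₀ hC) (one_le_pow₀ (by linarith))
    nlinarith
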